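/- Let $\mathcal{Q}_2$ be the universal unital $C^*$-algebra generated by a unitary $U$ and an isometry $S_2$ with $S_2U=U^2S_2$ and $S_2S_2^*+US_2S_2^*U^*=1$, and let $\mathcal{O}_2$ be the Cuntz algebra, i.e. the universal unital $C^*$-algebra generated by two isometries $S_1,S_2$ with $S_1S_1^*+S_2S_2^*=1$, included in $\mathcal{Q}_2$ through $S_1\mapsto US_2$, $S_2\mapsto S_2$. A pure state $\omega$ of $\mathcal{O}_2$ has the unique extension property if there is exactly one pure state $\Omega$ of $\mathcal{Q}_2$ whose restriction to $\mathcal{O}_2$ is $\omega$. An isometry $V$ on a Hilbert space is pure if $\bigcap_{n\ge1}\operatorname{Ran}(V^n)=0$. **Theorem.** Let $\pi:\mathcal{O}_2\to B(\mathcal{H})$ be an irreducible representation such that $\pi(S_1)$ and $\pi(S_2)$ are both pure. Then for every unit vector $x\in\mathcal{H}$ the vector state $\omega_x(T)=(\pi(T)x,x)$ is a pure state of $\mathcal{O}_2$ with the unique extension property with respect to $\mathcal{O}_2\subset\mathcal{Q}_2$. **Corollary.** Let $\pi:\mathcal{O}_2\to B(\mathcal{H})$ be an irreducible permutative representation of type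 $P(I)$, where $I$ is a finite or infinite multi-index in the alphabet $\{1,2\}$ with $|I|\ge2$ (so $I$ may be infinite). Then for every unit vector $x\in\mathcal{H}$ the vector state $\omega_x$ is a pure state of $\mathcal{O}_2$ with the unique extension property with respect to $\mathcal{O}_2\subset\mathcal{Q}_2$. Here $\pi$ is permutative if there are an orthonormal basis $(e_n)_{n\in\mathbb{N}}$ of $\mathcal{H}$ and injections $\sigma_1,\sigma_2:\mathbb{N}\to\mathbb{N}$ whose ranges are disjoint and cover $\mathbb{N}$, with $\pi(S_i)e_n=e_{\sigma_i(n)}$ for all $i,n$. It is of type $P(I)$ if, for some such basis, some basis vector $v$ is cyclic for $\pi$ and satisfies the following. If $I=(i_1,\dots,i_k)$ is finite: $\pi(S_{i_1}\cdots S_{i_k})v=v$ and the vectors $v,\ \pi(S_{i_1})v,\ \dots,\ \pi(S_{i_1}\cdots S_{i_{k-1}})v$ are orthonormal. If $I=(i_1,i_2,\dots)$ is infinite: the vectors $\pi(S_{i_1}\cdots S_{i_n})^*v$, $n\ge0$, are orthonormal. -/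

import Mathlib

open scoped ComplexOrder

noncomputable section

/-! ### The free unital `*`-algebra on a set of generators -/

/-- The free unital complex `*`-algebra on `X`: the monoid algebra of words in the letters
`(x, false)`, standing for `x`, and `(x, true)`, standing for the adjoint of `x`. -/
abbrev FreeStarAlg (X : Type) : Type := MonoidAlgebra ℂ (FreeMonoid (X × Bool))

namespace FreeStarAlg

variable {X : Type}

/-- The generator `x`. -/
def gen (x : X) : FreeStarAlg X := MonoidAlgebra.single (FreeMonoid.of (x, false)) 1

/-- The conjugate-linear ring homomorphism out of a monoid algebra extending `g`. -/
def conjLift {M B : Type*} [Monoid M] [Ring B] [Algebra ℂ B] (g : M →* B) :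
    MonoidAlgebra ℂ M →+* B :=
  MonoidAlgebra.liftNCRingHom ((algebraMap ℂ B).comp (starRingEnd ℂ)) g
    (fun c w => Algebra.commutes (starRingEnd ℂ c) (g w))

theorem conjLift_single {M B : Type*} [Monoid M] [Ring B] [Algebra ℂ B] (g : M →* B)
    (w : M) (c : ℂ) :
    conjLift g (MonoidAlgebra.single w c) = (starRingEnd ℂ c) • g w := by
  rw [Algebra.smul_def]
  exact MonoidAlgebra.liftNC_single _ _ _ _

/-- The conjugate-linear anti-endomorphism exchanging the letters `x` and `x*`. -/
def starHom : FreeStarAlg X →+* (FreeStarAlg X)ᵐᵒᵖ :=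
  conjLift (FreeMonoid.lift fun l : X × Bool =>
    MulOpposite.op (MonoidAlgebra.single (FreeMonoid.of (l.1, !l.2)) (1 : ℂ)))

theorem starHom_single (w : FreeMonoid (X × Bool)) (c : ℂ) :
    starHom (MonoidAlgebra.single w c) =
      (starRingEnd ℂ c) • FreeMonoid.lift (fun l : X × Bool =>
        MulOpposite.op (MonoidAlgebra.single (FreeMonoid.of (l.1, !l.2)) (1 : ℂ))) w :=
  conjLift_single _ _ _

theorem starHom_algebraMap (c : ℂ) :
    starHom (algebraMap ℂ (FreeStarAlg X) c) = algebraMap ℂ _ (starRingEnd ℂ c) := by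
  have : algebraMap ℂ (FreeStarAlg X) c = MonoidAlgebra.single 1 c := rfl
  rw [this, starHom_single, map_one, Algebra.algebraMap_eq_smul_one]

theorem starHom_smul (c : ℂ) (a : FreeStarAlg X) :
    starHom (c • a) = (starRingEnd ℂ c) • starHom a := by
  rw [Algebra.smul_def, map_mul, starHom_algebraMap, ← Algebra.smul_def]

theorem induction' {p : FreeStarAlg X → Prop} (h1 : p 1)
    (hl : ∀ l : X × Bool, p (MonoidAlgebra.single (FreeMonoid.of l) 1))
    (hm : ∀ a b, p a → p b → p (a * b)) (ha : ∀ a b, p a → p b → p (a + b))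
    (hs : ∀ (c : ℂ) a, p a → p (c • a)) (a : FreeStarAlg X) : p a := by
  refine MonoidAlgebra.induction_on a (fun w => ?_) ha (fun c a => hs c a)
  have hw : ∀ w : FreeMonoid (X × Bool), p (MonoidAlgebra.of ℂ _ w) := fun w => by
    induction w using FreeMonoid.inductionOn with
    | one => rw [map_one]; exact h1
    | of l => exact hl l
    | mul v w hv hw => rw [map_mul]; exact hm _ _ hv hw
  exact hw w

instance : StarRing (FreeStarAlg X) where
  star a := (starHom a).unop
  star_involutive a := by
    induction a using induction' with
    | h1 => simp
    | hl l => simp [starHom_single]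
    | hm a b ha hb => simp only [map_mul, MulOpposite.unop_mul, ha, hb]
    | ha a b ha hb => simp only [map_add, MulOpposite.unop_add, ha, hb]
    | hs c a ha => simp only [starHom_smul, MulOpposite.unop_smul, ha, Complex.conj_conj]
  star_mul a b := by simp
  star_add a b := by simp

theorem star_def (a : FreeStarAlg X) : star a = (starHom a).unop := rfl

instance : StarModule ℂ (FreeStarAlg X) where
  star_smul c a := by simp [star_def, starHom_smul]

theorem star_letter (l : X × Bool) :
    star (MonoidAlgebra.single (FreeMonoid.of l) (1 : ℂ) : FreeStarAlg X) =
      MonoidAlgebra.single (FreeMonoid.of (l.1, !l.2)) 1 := by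
  simp [star_def, starHom_single]

/-- Evaluation of the generators at elements of a unital `*`-algebra. -/
def eval {B : Type*} [Ring B] [StarRing B] [Algebra ℂ B] [StarModule ℂ B] (f : X → B) :
    FreeStarAlg X →⋆ₐ[ℂ] B :=
  { MonoidAlgebra.lift ℂ B (FreeMonoid (X × Bool))
      (FreeMonoid.lift fun l : X × Bool => if l.2 then star (f l.1) else f l.1) with
    map_star' := fun a => by
      change MonoidAlgebra.lift ℂ B _ _ _ = star (MonoidAlgebra.lift ℂ B _ _ _)
      induction a using induction' with
      | h1 => simp
      | hl l => rw [star_letter]; rcases l with ⟨x, _ | _⟩ <;> simp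
      | hm a b ha hb => simp only [star_mul, map_mul, ha, hb]
      | ha a b ha hb => simp only [star_add, map_add, ha, hb]
      | hs c a ha => simp only [star_smul, map_smul, ha] }

theorem eval_gen {B : Type*} [Ring B] [StarRing B] [Algebra ℂ B] [StarModule ℂ B] (f : X → B)
    (x : X) : eval f (gen x) = f x := by
  change MonoidAlgebra.lift ℂ B _ _ (MonoidAlgebra.single _ _) = _
  simp

theorem eval_star {B : Type*} [Ring B] [StarRing B] [Algebra ℂ B] [StarModule ℂ B] (f : X → B)
    (a : FreeStarAlg X) : eval f (star a) = star (eval f a) := map_star (eval f) a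

end FreeStarAlg

/-! ### The universal unital C*-algebra on contractive generators with relations -/

/-- `q` is a C*-seminorm on the free `*`-algebra for which the generators are contractions and
which vanishes on the relators in `R`. -/
structure IsAdmissible {X : Type} (R : Set (FreeStarAlg X)) (q : Seminorm ℂ (FreeStarAlg X)) :
    Prop where
  mul_le : ∀ a b, q (a * b) ≤ q a * q b
  star_mul_self : ∀ a, q (star a * a) = q a ^ 2
  gen_le : ∀ x, q (FreeStarAlg.gen x) ≤ 1
  rel : ∀ r ∈ R, q r = 0

namespace IsAdmissible

variable {X : Type} {R : Set (FreeStarAlg X)} {q : Seminorm ℂ (FreeStarAlg X)}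

theorem le_star (h : IsAdmissible R q) (a : FreeStarAlg X) : q a ≤ q (star a) := by
  rcases (apply_nonneg q a).eq_or_lt with h0 | h0
  · rw [← h0]; exact apply_nonneg q _
  · have h1 := h.star_mul_self a
    have h2 := h.mul_le (star a) a
    rw [h1, pow_two] at h2
    exact le_of_mul_le_mul_right h2 h0

theorem star_eq (h : IsAdmissible R q) (a : FreeStarAlg X) : q (star a) = q a :=
  le_antisymm (by simpa using h.le_star (star a)) (h.le_star a)

theorem one_le (h : IsAdmissible R q) : q 1 ≤ 1 := by
  have h1 := h.star_mul_self 1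
  rw [star_one, one_mul] at h1
  nlinarith [apply_nonneg q 1]

theorem zero : IsAdmissible R (0 : Seminorm ℂ (FreeStarAlg X)) where
  mul_le := by simp
  star_mul_self := by simp
  gen_le := by simp
  rel := by simp

end IsAdmissible

namespace FreeStarAlg

variable {X : Type} (R : Set (FreeStarAlg X))

theorem exists_bound (a : FreeStarAlg X) :
    ∃ C : ℝ, 0 ≤ C ∧ ∀ q : Seminorm ℂ (FreeStarAlg X), IsAdmissible R q → q a ≤ C := by
  induction a using induction' with
  | h1 => exact ⟨1, zero_le_one, fun q hq => hq.one_le⟩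
  | hl l =>
    refine ⟨1, zero_le_one, fun q hq => ?_⟩
    rcases l with ⟨x, _ | _⟩
    · exact hq.gen_le x
    · have h := star_letter (x, false)
      change _ = MonoidAlgebra.single (FreeMonoid.of (x, true)) (1 : ℂ) at h
      rw [← h, hq.star_eq]
      exact hq.gen_le x
  | hm a b ha hb =>
    obtain ⟨C, hC, h⟩ := ha
    obtain ⟨D, hD, k⟩ := hb
    exact ⟨C * D, mul_nonneg hC hD, fun q hq => (hq.mul_le a b).trans
      (mul_le_mul (h q hq) (k q hq) (apply_nonneg q b) hC)⟩
  | ha a b ha hb =>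
    obtain ⟨C, hC, h⟩ := ha
    obtain ⟨D, hD, k⟩ := hb
    exact ⟨C + D, add_nonneg hC hD, fun q hq => (map_add_le_add q a b).trans
      (add_le_add (h q hq) (k q hq))⟩
  | hs c a ha =>
    obtain ⟨C, hC, h⟩ := ha
    exact ⟨‖c‖ * C, by positivity, fun q hq => by
      rw [map_smul_eq_mul]; exact mul_le_mul_of_nonneg_left (h q hq) (norm_nonneg c)⟩

/-- The largest admissible C*-seminorm: the supremum of all of them. -/
def univNorm (a : FreeStarAlg X) : ℝ :=
  ⨆ q : {q : Seminorm ℂ (FreeStarAlg X) // IsAdmissible R q}, q.1 a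

instance : Nonempty {q : Seminorm ℂ (FreeStarAlg X) // IsAdmissible R q} :=
  ⟨⟨0, IsAdmissible.zero⟩⟩

variable {R}

theorem le_univNorm {q : Seminorm ℂ (FreeStarAlg X)} (hq : IsAdmissible R q)
    (a : FreeStarAlg X) : q a ≤ univNorm R a := by
  obtain ⟨C, -, h⟩ := exists_bound R a
  exact le_ciSup (f := fun q : {q : Seminorm ℂ (FreeStarAlg X) // IsAdmissible R q} => q.1 a)
    ⟨C, by rintro _ ⟨q, rfl⟩; exact h q.1 q.2⟩ ⟨q, hq⟩

theorem univNorm_le {a : FreeStarAlg X} {C : ℝ}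
    (h : ∀ q : Seminorm ℂ (FreeStarAlg X), IsAdmissible R q → q a ≤ C) : univNorm R a ≤ C :=
  ciSup_le fun q => h q.1 q.2

theorem univNorm_nonneg (a : FreeStarAlg X) : 0 ≤ univNorm R a :=
  (apply_nonneg (0 : Seminorm ℂ (FreeStarAlg X)) a).trans (le_univNorm IsAdmissible.zero a)

theorem univNorm_smul_le (c : ℂ) (a : FreeStarAlg X) :
    univNorm R (c • a) ≤ ‖c‖ * univNorm R a :=
  univNorm_le fun q hq => by
    rw [map_smul_eq_mul]
    exact mul_le_mul_of_nonneg_left (le_univNorm hq a) (norm_nonneg c)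

theorem univNorm_mul_le (a b : FreeStarAlg X) :
    univNorm R (a * b) ≤ univNorm R a * univNorm R b :=
  univNorm_le fun q hq => (hq.mul_le a b).trans
    (mul_le_mul (le_univNorm hq a) (le_univNorm hq b) (apply_nonneg q b) (univNorm_nonneg a))

theorem univNorm_star (a : FreeStarAlg X) : univNorm R (star a) = univNorm R a := by
  unfold univNorm
  exact iSup_congr fun q => q.2.star_eq a

theorem univNorm_sq_le (a : FreeStarAlg X) :
    univNorm R a * univNorm R a ≤ univNorm R (star a * a) := by
  have h : univNorm R a ≤ Real.sqrt (univNorm R (star a * a)) :=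
    univNorm_le fun q hq => Real.le_sqrt_of_sq_le
      ((hq.star_mul_self a).symm.le.trans (le_univNorm hq _))
  calc univNorm R a * univNorm R a
      ≤ Real.sqrt (univNorm R (star a * a)) * Real.sqrt (univNorm R (star a * a)) :=
        mul_self_le_mul_self (univNorm_nonneg a) h
    _ = _ := Real.mul_self_sqrt (univNorm_nonneg _)

end FreeStarAlg

open FreeStarAlg in
/-- The free `*`-algebra on `X` as a seminormed algebra under the largest admissible
C*-seminorm. -/
def PreUniv {X : Type} (_R : Set (FreeStarAlg X)) : Type := FreeStarAlg X

namespace PreUniv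

open FreeStarAlg

variable {X : Type} (R : Set (FreeStarAlg X))

instance : Ring (PreUniv R) := inferInstanceAs (Ring (FreeStarAlg X))
instance : StarRing (PreUniv R) := inferInstanceAs (StarRing (FreeStarAlg X))
instance : Algebra ℂ (PreUniv R) := inferInstanceAs (Algebra ℂ (FreeStarAlg X))
instance : StarModule ℂ (PreUniv R) := inferInstanceAs (StarModule ℂ (FreeStarAlg X))

/-- The universal seminorm, as a ring seminorm. -/
def ringSeminorm : RingSeminorm (PreUniv R) where
  toFun a := univNorm R a
  map_zero' := le_antisymm (univNorm_le fun q _ => (map_zero q).le) (univNorm_nonneg _)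
  add_le' a b := univNorm_le fun q hq => (map_add_le_add q _ _).trans
    (add_le_add (le_univNorm hq a) (le_univNorm hq b))
  neg' a := by
    unfold univNorm
    exact iSup_congr fun q => map_neg_eq_map q.1 a
  mul_le' a b := univNorm_mul_le a b

instance : SeminormedRing (PreUniv R) :=
  { (ringSeminorm R).toSeminormedRing with
    toRing := inferInstanceAs (Ring (PreUniv R)) }

theorem norm_def (a : PreUniv R) : ‖a‖ = univNorm R a := rfl

instance : NormedAlgebra ℂ (PreUniv R) where
  norm_smul_le c a := univNorm_smul_le c a

instance : NormedStarGroup (PreUniv R) where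
  norm_star_le a := (univNorm_star (R := R) a).le

end PreUniv

/-- The universal unital C*-algebra generated by contractions `x ∈ X` subject to the
relations `r = 0`, `r ∈ R`: the Hausdorff completion of the free `*`-algebra for the largest
admissible C*-seminorm. -/
def UnivCStar {X : Type} (R : Set (FreeStarAlg X)) : Type :=
  UniformSpace.Completion (PreUniv R)

namespace UnivCStar

open UniformSpace FreeStarAlg

variable {X : Type} (R : Set (FreeStarAlg X))

instance : NormedRing (UnivCStar R) := inferInstanceAs (NormedRing (Completion (PreUniv R)))
instance : CompleteSpace (UnivCStar R) :=
  inferInstanceAs (CompleteSpace (Completion (PreUniv R)))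
instance : Algebra ℂ (UnivCStar R) := inferInstanceAs (Algebra ℂ (Completion (PreUniv R)))
instance : NormedAlgebra ℂ (UnivCStar R) where
  norm_smul_le c a := norm_smul_le (α := ℂ) (β := Completion (PreUniv R)) c a

/-- The canonical map of the free `*`-algebra into the universal C*-algebra. -/
def coe (a : PreUniv R) : UnivCStar R := (a : Completion (PreUniv R))

theorem continuous_coe : Continuous (coe R) := Completion.continuous_coe _

theorem denseRange_coe : DenseRange (coe R) := Completion.denseRange_coe

theorem norm_coe (a : PreUniv R) : ‖coe R a‖ = univNorm R a := Completion.norm_coe _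

theorem uniformContinuous_star : UniformContinuous (star : PreUniv R → PreUniv R) :=
  (AddMonoidHomClass.isometry_of_norm (starAddEquiv : PreUniv R ≃+ PreUniv R)
    (fun a => norm_star a)).uniformContinuous

/-- The continuous extension of the adjoint to the completion. -/
def starFun : UnivCStar R → UnivCStar R :=
  Completion.map (star : PreUniv R → PreUniv R)

theorem continuous_starFun : Continuous (starFun R) := Completion.continuous_map

theorem starFun_coe (a : PreUniv R) : starFun R (coe R a) = coe R (star a) :=
  Completion.map_coe (uniformContinuous_star R) a

variable {R}

theorem coe_add (a b : PreUniv R) : coe R (a + b) = coe R a + coe R b := Completion.coe_add a b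
theorem coe_mul (a b : PreUniv R) : coe R (a * b) = coe R a * coe R b := Completion.coe_mul a b
theorem coe_smul (c : ℂ) (a : PreUniv R) : coe R (c • a) = c • coe R a := Completion.coe_smul c a
theorem coe_one : coe R 1 = 1 := rfl
theorem coe_zero : coe R 0 = 0 := rfl

theorem ind {p : UnivCStar R → Prop} (hc : IsClosed {a | p a}) (h : ∀ a, p (coe R a))
    (a : UnivCStar R) : p a := Completion.induction_on a hc h

theorem ind₂ {p : UnivCStar R → UnivCStar R → Prop} (hc : IsClosed {a : _ × _ | p a.1 a.2})
    (h : ∀ a b, p (coe R a) (coe R b)) (a b : UnivCStar R) : p a b :=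
  Completion.induction_on₂ a b hc h

instance : StarRing (UnivCStar R) where
  star := starFun R
  star_involutive a := by
    refine ind (p := fun a => starFun R (starFun R a) = a) ?_ (fun a => ?_) a
    · exact isClosed_eq ((continuous_starFun R).comp (continuous_starFun R)) continuous_id
    · rw [starFun_coe, starFun_coe, star_star]
  star_mul a b := by
    refine ind₂ (p := fun a b => starFun R (a * b) = starFun R b * starFun R a) ?_
      (fun a b => ?_) a b
    · have := continuous_starFun R
      exact isClosed_eq (by fun_prop) (by fun_prop)
    · rw [← coe_mul, starFun_coe, starFun_coe, starFun_coe, ← coe_mul, star_mul]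
  star_add a b := by
    refine ind₂ (p := fun a b => starFun R (a + b) = starFun R a + starFun R b) ?_
      (fun a b => ?_) a b
    · have := continuous_starFun R
      exact isClosed_eq (by fun_prop) (by fun_prop)
    · rw [← coe_add, starFun_coe, starFun_coe, starFun_coe, ← coe_add, star_add]

theorem continuous_star' : Continuous (star : UnivCStar R → UnivCStar R) := continuous_starFun R

theorem coe_star (a : PreUniv R) : coe R (star a) = star (coe R a) := (starFun_coe R a).symm

instance : StarModule ℂ (UnivCStar R) where
  star_smul c a := by
    refine ind (p := fun a => star (c • a) = star c • star a) ?_ (fun a => ?_) a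
    · exact isClosed_eq (continuous_star'.comp (continuous_const_smul c))
        ((continuous_const_smul (star c)).comp continuous_star')
    · rw [← coe_smul, ← coe_star, ← coe_star, ← coe_smul, star_smul]

instance : CStarRing (UnivCStar R) where
  norm_mul_self_le a := by
    refine ind (p := fun a => ‖a‖ * ‖a‖ ≤ ‖star a * a‖) ?_ (fun a => ?_) a
    · have := continuous_star' (R := R)
      exact isClosed_le (by fun_prop) (by fun_prop)
    · rw [← coe_star, ← coe_mul, norm_coe, norm_coe]
      exact univNorm_sq_le (R := R) a

instance : CStarAlgebra (UnivCStar R) where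

/-- The canonical generators of the universal C*-algebra. -/
def gen (x : X) : UnivCStar R := coe R (FreeStarAlg.gen x)

variable (R) in
/-- The canonical `*`-homomorphism of the free `*`-algebra into the universal C*-algebra. -/
def coeHom : FreeStarAlg X →⋆ₐ[ℂ] UnivCStar R where
  toFun a := coe R a
  map_one' := rfl
  map_mul' := coe_mul
  map_zero' := rfl
  map_add' := coe_add
  commutes' c := by
    rw [Algebra.algebraMap_eq_smul_one, Algebra.algebraMap_eq_smul_one]
    exact coe_smul c 1
  map_star' := coe_star

theorem coeHom_gen (x : X) : coeHom R (FreeStarAlg.gen x) = gen x := rfl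

theorem coeHom_rel {r : FreeStarAlg X} (hr : r ∈ R) : coeHom R r = 0 := by
  rw [← norm_eq_zero]
  refine (norm_coe R r).trans ?_
  exact le_antisymm (univNorm_le fun q hq => (hq.rel r hr).le) (univNorm_nonneg r)

section lift

variable {B : Type*} [CStarAlgebra B] {f : X → B}

theorem isAdmissible_eval (hf : ∀ x, ‖f x‖ ≤ 1) (hR : ∀ r ∈ R, eval f r = 0) :
    IsAdmissible R ((normSeminorm ℂ B).comp (eval f).toAlgHom.toLinearMap) where
  mul_le a b := by
    change ‖eval f (a * b)‖ ≤ ‖eval f a‖ * ‖eval f b‖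
    rw [map_mul]; exact norm_mul_le _ _
  star_mul_self a := by
    change ‖eval f (star a * a)‖ = ‖eval f a‖ ^ 2
    rw [map_mul, map_star, CStarRing.norm_star_mul_self, pow_two]
  gen_le x := by
    change ‖eval f (FreeStarAlg.gen x)‖ ≤ 1
    rw [eval_gen]; exact hf x
  rel r hr := by
    change ‖eval f r‖ = 0
    rw [hR r hr, norm_zero]

theorem norm_eval_le (hf : ∀ x, ‖f x‖ ≤ 1) (hR : ∀ r ∈ R, eval f r = 0) (a : FreeStarAlg X) :
    ‖eval f a‖ ≤ univNorm R a :=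
  le_univNorm (isAdmissible_eval hf hR) a

variable (R f) in
/-- Evaluation, as an additive map on the seminormed free `*`-algebra. -/
def preEval : PreUniv R →+ B :=
  (eval f : FreeStarAlg X →⋆ₐ[ℂ] B).toAlgHom.toLinearMap.toAddMonoidHom

theorem uniformContinuous_preEval (hf : ∀ x, ‖f x‖ ≤ 1) (hR : ∀ r ∈ R, eval f r = 0) :
    UniformContinuous (preEval R f) :=
  uniformContinuous_addMonoidHom_of_continuous
    (AddMonoidHomClass.continuous_of_bound (preEval R f) 1
      (fun a => by rw [one_mul]; exact norm_eval_le hf hR a))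

variable (R) in
/-- The continuous extension of evaluation to the completion. -/
def liftFun (f : X → B) : UnivCStar R → B :=
  Completion.extension (preEval R f)

variable (R) in
theorem continuous_liftFun (f : X → B) : Continuous (liftFun R f) := Completion.continuous_extension

theorem liftFun_coe (hf : ∀ x, ‖f x‖ ≤ 1) (hR : ∀ r ∈ R, eval f r = 0) (a : PreUniv R) :
    liftFun R f (coe R a) = preEval R f a :=
  Completion.extension_coe (uniformContinuous_preEval hf hR) a

/-- The universal property: contractions in a unital C*-algebra satisfying the relations are
the images of the generators under a unital `*`-homomorphism. -/
def lift (f : X → B) (hf : ∀ x, ‖f x‖ ≤ 1) (hR : ∀ r ∈ R, eval f r = 0) :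
    UnivCStar R →⋆ₐ[ℂ] B where
  toFun := liftFun R f
  map_one' := (liftFun_coe hf hR 1).trans (map_one (eval f))
  map_zero' := (liftFun_coe hf hR 0).trans (map_zero (eval f))
  map_mul' a b := by
    have := continuous_liftFun R f
    refine ind₂ (p := fun a b => liftFun R f (a * b) = liftFun R f a * liftFun R f b)
      (isClosed_eq (by fun_prop) (by fun_prop)) (fun a b => ?_) a b
    rw [← coe_mul, liftFun_coe hf hR, liftFun_coe hf hR, liftFun_coe hf hR]
    exact map_mul (eval f) _ _
  map_add' a b := by
    have := continuous_liftFun R f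
    refine ind₂ (p := fun a b => liftFun R f (a + b) = liftFun R f a + liftFun R f b)
      (isClosed_eq (by fun_prop) (by fun_prop)) (fun a b => ?_) a b
    rw [← coe_add, liftFun_coe hf hR, liftFun_coe hf hR, liftFun_coe hf hR]
    exact map_add (preEval R f) _ _
  commutes' c := by
    have h : algebraMap ℂ (UnivCStar R) c = coe R (algebraMap ℂ (FreeStarAlg X) c) :=
      ((coeHom R).toAlgHom.commutes c).symm
    rw [h]
    refine (liftFun_coe hf hR _).trans ?_
    exact (eval f).toAlgHom.commutes c
  map_star' a := by
    have := continuous_liftFun R f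
    have h' := continuous_star' (R := R)
    refine ind (p := fun a => liftFun R f (star a) = star (liftFun R f a))
      (isClosed_eq (by fun_prop) (by fun_prop)) (fun a => ?_) a
    rw [← coe_star, liftFun_coe hf hR, liftFun_coe hf hR]
    exact map_star (eval f) _

theorem lift_gen (hf : ∀ x, ‖f x‖ ≤ 1) (hR : ∀ r ∈ R, eval f r = 0) (x : X) :
    lift f hf hR (gen x) = f x :=
  (liftFun_coe hf hR _).trans (eval_gen f x)

/-- Unital `*`-homomorphisms out of the universal C*-algebra agree if they agree on the
generators. -/
theorem hom_ext {φ ψ : UnivCStar R →⋆ₐ[ℂ] B} (h : ∀ x, φ (gen x) = ψ (gen x)) : φ = ψ := by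
  have hφ : Continuous φ :=
    AddMonoidHomClass.continuous_of_bound φ 1
      (fun a => by rw [one_mul]; exact NonUnitalStarAlgHom.norm_apply_le φ a)
  have hψ : Continuous ψ :=
    AddMonoidHomClass.continuous_of_bound ψ 1
      (fun a => by rw [one_mul]; exact NonUnitalStarAlgHom.norm_apply_le ψ a)
  refine StarAlgHom.ext fun a => ?_
  refine ind (p := fun a => φ a = ψ a) (isClosed_eq hφ hψ) (fun a => ?_) a
  change φ (coeHom R a) = ψ (coeHom R a)
  induction a using induction' with
  | h1 => simp
  | hl l =>
    rcases l with ⟨x, _ | _⟩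
    · exact h x
    · have h1 := star_letter (x, false)
      change star (FreeStarAlg.gen x) = MonoidAlgebra.single (FreeMonoid.of (x, true)) (1 : ℂ) at h1
      rw [← h1, map_star, map_star, map_star]
      exact congrArg star (h x)
  | hm a b ha hb => simp only [map_mul, ha, hb]
  | ha a b ha hb => simp only [map_add, ha, hb]
  | hs c a ha => simp only [map_smul, ha]

end lift

end UnivCStar

theorem norm_le_one_of_isometry {B : Type*} [CStarAlgebra B] {s : B} (h : star s * s = 1) :
    ‖s‖ ≤ 1 := by
  have h1 : ‖(1 : B)‖ * ‖(1 : B)‖ = ‖(1 : B)‖ := by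
    have := CStarRing.norm_star_mul_self (x := (1 : B))
    rw [star_one, one_mul] at this
    exact this.symm
  have h2 : ‖s‖ * ‖s‖ = ‖(1 : B)‖ := by rw [← CStarRing.norm_star_mul_self, h]
  have h3 : ‖(1 : B)‖ ≤ 1 := by nlinarith [norm_nonneg (1 : B)]
  nlinarith [norm_nonneg s]

/-! ### The Cuntz algebra `O₂` -/

/-- The relators of the Cuntz algebra: two isometries whose range projections sum to `1`. The
letters `1, 2` of the usual notation are `0, 1 : Fin 2`. -/
def o2Rel : Set (FreeStarAlg (Fin 2)) :=
  {r | (∃ i, r = star (FreeStarAlg.gen i) * FreeStarAlg.gen i - 1) ∨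
    r = FreeStarAlg.gen 0 * star (FreeStarAlg.gen 0) +
      FreeStarAlg.gen 1 * star (FreeStarAlg.gen 1) - 1}

/-- The Cuntz algebra `O₂`: the universal C*-algebra generated by two isometries `S₁, S₂` with
`S₁S₁* + S₂S₂* = 1`. -/
abbrev O2 : Type := UnivCStar o2Rel

namespace O2

/-- The generating isometries: `S 0` is `S₁` and `S 1` is `S₂`. -/
def S (i : Fin 2) : O2 := UnivCStar.gen i

theorem isometry_S (i : Fin 2) : star (S i) * S i = 1 := by
  have h := UnivCStar.coeHom_rel (R := o2Rel) (Or.inl ⟨i, rfl⟩)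
  simp only [map_sub, map_mul, map_star, map_one, UnivCStar.coeHom_gen] at h
  exact sub_eq_zero.mp h

theorem range_S : S 0 * star (S 0) + S 1 * star (S 1) = 1 := by
  have h := UnivCStar.coeHom_rel (R := o2Rel) (Or.inr rfl)
  simp only [map_sub, map_add, map_mul, map_star, map_one, UnivCStar.coeHom_gen] at h
  exact sub_eq_zero.mp h

variable {B : Type*} [CStarAlgebra B]

/-- The universal property of `O₂`. -/
def lift (s : Fin 2 → B) (h : ∀ i, star (s i) * s i = 1)
    (h' : s 0 * star (s 0) + s 1 * star (s 1) = 1) : O2 →⋆ₐ[ℂ] B :=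
  UnivCStar.lift s (fun i => norm_le_one_of_isometry (h i)) (by
    rintro r (⟨i, rfl⟩ | rfl)
    · simp [FreeStarAlg.eval_star, FreeStarAlg.eval_gen, h]
    · simp [FreeStarAlg.eval_star, FreeStarAlg.eval_gen, h'])

theorem lift_S (s : Fin 2 → B) (h : ∀ i, star (s i) * s i = 1)
    (h' : s 0 * star (s 0) + s 1 * star (s 1) = 1) (i : Fin 2) : lift s h h' (S i) = s i :=
  UnivCStar.lift_gen _ _ i

theorem hom_ext {φ ψ : O2 →⋆ₐ[ℂ] B} (h : ∀ i, φ (S i) = ψ (S i)) : φ = ψ :=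
  UnivCStar.hom_ext h

end O2

/-! ### The 2-adic ring C*-algebra `Q₂` -/

/-- The two generators of `Q₂`. -/
inductive Q2Gen : Type
  | u : Q2Gen
  | s : Q2Gen

/-- The relators of `Q₂`: `U` is unitary, `S₂` is an isometry, `S₂U = U²S₂` and
`S₂S₂* + US₂S₂*U* = 1`. -/
def q2Rel : Set (FreeStarAlg Q2Gen) :=
  {star (FreeStarAlg.gen .u) * FreeStarAlg.gen .u - 1,
    FreeStarAlg.gen .u * star (FreeStarAlg.gen .u) - 1,
    star (FreeStarAlg.gen .s) * FreeStarAlg.gen .s - 1,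
    FreeStarAlg.gen .s * FreeStarAlg.gen .u - FreeStarAlg.gen .u ^ 2 * FreeStarAlg.gen .s,
    FreeStarAlg.gen .s * star (FreeStarAlg.gen .s) +
      FreeStarAlg.gen .u * FreeStarAlg.gen .s * star (FreeStarAlg.gen .s) *
        star (FreeStarAlg.gen .u) - 1}

/-- The 2-adic ring C*-algebra `Q₂`: the universal C*-algebra generated by a unitary `U` and an
isometry `S₂` with `S₂U = U²S₂` and `S₂S₂* + US₂S₂*U* = 1`. -/
abbrev Q2 : Type := UnivCStar q2Rel

namespace Q2

/-- The generating unitary. -/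
def U : Q2 := UnivCStar.gen .u

/-- The generating isometry. -/
def S₂ : Q2 := UnivCStar.gen .s

theorem star_U_mul_U : star U * U = 1 := by
  have h := UnivCStar.coeHom_rel (R := q2Rel) (Or.inl rfl)
  simp only [map_sub, map_mul, map_star, map_one, UnivCStar.coeHom_gen] at h
  exact sub_eq_zero.mp h

theorem U_mul_star_U : U * star U = 1 := by
  have h := UnivCStar.coeHom_rel (R := q2Rel) (Or.inr (Or.inl rfl))
  simp only [map_sub, map_mul, map_star, map_one, UnivCStar.coeHom_gen] at h
  exact sub_eq_zero.mp h

theorem star_S₂_mul_S₂ : star S₂ * S₂ = 1 := by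
  have h := UnivCStar.coeHom_rel (R := q2Rel) (Or.inr (Or.inr (Or.inl rfl)))
  simp only [map_sub, map_mul, map_star, map_one, UnivCStar.coeHom_gen] at h
  exact sub_eq_zero.mp h

theorem S₂_mul_U : S₂ * U = U ^ 2 * S₂ := by
  have h := UnivCStar.coeHom_rel (R := q2Rel) (Or.inr (Or.inr (Or.inr (Or.inl rfl))))
  simp only [map_sub, map_mul, map_pow, UnivCStar.coeHom_gen] at h
  exact sub_eq_zero.mp h

theorem range_S₂ : S₂ * star S₂ + U * S₂ * star S₂ * star U = 1 := by
  have h := UnivCStar.coeHom_rel (R := q2Rel) (Or.inr (Or.inr (Or.inr (Or.inr rfl))))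
  simp only [map_sub, map_add, map_mul, map_star, map_one, UnivCStar.coeHom_gen] at h
  exact sub_eq_zero.mp h

variable {B : Type*} [CStarAlgebra B]

/-- The universal property of `Q₂`. -/
def lift (u s : B) (hu : star u * u = 1) (hu' : u * star u = 1) (hs : star s * s = 1)
    (hsu : s * u = u ^ 2 * s) (h : s * star s + u * s * star s * star u = 1) : Q2 →⋆ₐ[ℂ] B :=
  UnivCStar.lift (fun g => match g with | .u => u | .s => s)
    (by rintro (_ | _)
        · exact norm_le_one_of_isometry hu
        · exact norm_le_one_of_isometry hs) (by
    rintro r (rfl | rfl | rfl | rfl | rfl)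
    · simp [FreeStarAlg.eval_star, FreeStarAlg.eval_gen, hu]
    · simp [FreeStarAlg.eval_star, FreeStarAlg.eval_gen, hu']
    · simp [FreeStarAlg.eval_star, FreeStarAlg.eval_gen, hs]
    · simp [FreeStarAlg.eval_gen, hsu]
    · simp [FreeStarAlg.eval_star, FreeStarAlg.eval_gen, h])

theorem lift_U (u s : B) (hu : star u * u = 1) (hu' : u * star u = 1) (hs : star s * s = 1)
    (hsu : s * u = u ^ 2 * s) (h : s * star s + u * s * star s * star u = 1) :
    lift u s hu hu' hs hsu h U = u := UnivCStar.lift_gen _ _ _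

theorem lift_S₂ (u s : B) (hu : star u * u = 1) (hu' : u * star u = 1) (hs : star s * s = 1)
    (hsu : s * u = u ^ 2 * s) (h : s * star s + u * s * star s * star u = 1) :
    lift u s hu hu' hs hsu h S₂ = s := UnivCStar.lift_gen _ _ _

theorem hom_ext {φ ψ : Q2 →⋆ₐ[ℂ] B} (hU : φ U = ψ U) (hS : φ S₂ = ψ S₂) : φ = ψ :=
  UnivCStar.hom_ext (by rintro (_ | _); exacts [hU, hS])

end Q2

/-- The inclusion `O₂ ⊂ Q₂`, with `S₁ ↦ US₂` and `S₂ ↦ S₂`. -/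
def O2.incl : O2 →⋆ₐ[ℂ] Q2 :=
  O2.lift ![Q2.U * Q2.S₂, Q2.S₂]
    (by
      intro i
      fin_cases i
      · change star (Q2.U * Q2.S₂) * (Q2.U * Q2.S₂) = 1
        rw [star_mul, mul_assoc, ← mul_assoc (star Q2.U), Q2.star_U_mul_U, one_mul,
          Q2.star_S₂_mul_S₂]
      · exact Q2.star_S₂_mul_S₂)
    (by
      change Q2.U * Q2.S₂ * star (Q2.U * Q2.S₂) + Q2.S₂ * star Q2.S₂ = 1
      rw [star_mul, ← mul_assoc, add_comm, Q2.range_S₂])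

/-! ### States -/

section States

variable {A : Type*} [CStarAlgebra A]

/-- A state: a positive linear functional with `ω 1 = 1`. -/
structure IsState (ω : A →ₗ[ℂ] ℂ) : Prop where
  nonneg : ∀ a, 0 ≤ ω (star a * a)
  map_one : ω 1 = 1

/-- A pure state: an extreme point of the convex set of states. -/
def IsPureState (ω : A →ₗ[ℂ] ℂ) : Prop :=
  ω ∈ Set.extremePoints ℝ {φ : A →ₗ[ℂ] ℂ | IsState φ}

end States

/-- A pure state `ω` of `O₂` with the unique extension property for `O₂ ⊂ Q₂`: exactly one pure
state of `Q₂` restricts to `ω`. -/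
def HasUniquePureExtension (ω : O2 →ₗ[ℂ] ℂ) : Prop :=
  IsPureState ω ∧
    ∃! Ω : Q2 →ₗ[ℂ] ℂ, IsPureState Ω ∧ Ω ∘ₗ O2.incl.toAlgHom.toLinearMap = ω

/-! ### Representations -/

section Representations

variable {H : Type*} [NormedAddCommGroup H] [InnerProductSpace ℂ H] [CompleteSpace H]

/-- The functional `T ↦ (π(T)x, x)`; the inner product of Mathlib is conjugate linear in its
first argument. -/
def vectorState {A : Type*} [CStarAlgebra A] (π : A →⋆ₐ[ℂ] (H →L[ℂ] H)) (x : H) :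
    A →ₗ[ℂ] ℂ where
  toFun T := inner ℂ x (π T x)
  map_add' S T := by simp
  map_smul' c T := by simp

/-- Irreducibility: the space is nonzero and has no closed invariant subspaces besides `0` and
the whole space. -/
def IsIrreducibleRep {A : Type*} [CStarAlgebra A] (π : A →⋆ₐ[ℂ] (H →L[ℂ] H)) : Prop :=
  Nontrivial H ∧ ∀ K : Submodule ℂ H, IsClosed (K : Set H) →
    (∀ T, ∀ v ∈ K, π T v ∈ K) → K = ⊥ ∨ K = ⊤

/-- A pure isometry: `⋂_{n ≥ 1} Ran(Vⁿ) = 0`. -/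
def IsPureIsometry (V : H →L[ℂ] H) : Prop :=
  star V * V = 1 ∧ ⨅ n : ℕ, LinearMap.range ((V ^ (n + 1) : H →L[ℂ] H) : H →ₗ[ℂ] H) = ⊥

/-- `π` is permutative: `π(S_i) e_n = e_{σ_i(n)}` for the orthonormal basis `e` and the branching
function system `σ`. -/
structure IsPermutative (π : O2 →⋆ₐ[ℂ] (H →L[ℂ] H)) (e : HilbertBasis ℕ ℂ H)
    (σ : Fin 2 → ℕ → ℕ) : Prop where
  injective : ∀ i, Function.Injective (σ i)
  disjoint : Disjoint (Set.range (σ 0)) (Set.range (σ 1))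
  union : Set.range (σ 0) ∪ Set.range (σ 1) = Set.univ
  map_S : ∀ i n, π (O2.S i) (e n) = e (σ i n)

/-- A finite or infinite multi-index in the alphabet of `S`. -/
inductive MultiIndex : Type
  | finite (w : List (Fin 2)) : MultiIndex
  | infinite (w : ℕ → Fin 2) : MultiIndex

/-- The length `|I|`. -/
def MultiIndex.length : MultiIndex → ℕ∞
  | .finite w => w.length
  | .infinite _ => ⊤

/-- `S_w = S_{i₁} S_{i₂} ⋯ S_{i_k}` for `w = (i₁, …, i_k)`. -/
def O2.word (w : List (Fin 2)) : O2 := (w.map O2.S).prod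

/-- The condition on the distinguished vector `v` of a representation of type `P(I)`.
If `I` is finite: `S_I v = v`, and `v, S_{i₁} v, …, S_{i₁} ⋯ S_{i_{k-1}} v` are orthonormal.
If `I` is infinite: the vectors `(S_{i₁} ⋯ S_{i_n})* v`, `n ≥ 0`, are orthonormal (in particular
they are nonzero). -/
def IsTypePVector (π : O2 →⋆ₐ[ℂ] (H →L[ℂ] H)) (v : H) : MultiIndex → Prop
  | .finite w => π (O2.word w) v = v ∧
      Orthonormal ℂ fun j : Fin w.length => π (O2.word (w.take j)) v
  | .infinite w => Orthonormal ℂ fun n : ℕ =>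
      π (star (O2.word (List.ofFn fun j : Fin n => w j))) v

/-- `π` is a permutative representation of type `P(I)`: it is permutative with respect to some
orthonormal basis, one of whose members is cyclic and satisfies the condition attached to `I`. -/
def IsTypeP (π : O2 →⋆ₐ[ℂ] (H →L[ℂ] H)) (I : MultiIndex) : Prop :=
  ∃ (e : HilbertBasis ℕ ℂ H) (σ : Fin 2 → ℕ → ℕ) (k : ℕ), IsPermutative π e σ ∧
    Dense (Set.range fun T : O2 => π T (e k)) ∧ IsTypePVector π (e k) I

end Representations

end

/-!
If `π(S₁)` and `π(S₂)` are pure, then `S_iⁿ*` tends strongly to `0`. In any extension of `π` to `Q₂`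
the unitary satisfies `U = S₁ S₂* + S₂ U S₁*`. The difference of two iterates of the map
`x ↦ S₁ S₂* + S₂ x S₁*` is `S₂ⁿ (x - y) S₁ⁿ*`, so its iterates converge strongly to its only fixed
point. This produces the extension of `π`, and the same contraction shows that whatever intertwines
two representations of `O₂` intertwines `U`. By the GNS construction a state of `Q₂` that restricts
to a vector state of `π` is therefore the vector state of that extension.

In an irreducible representation the core `⋂ Ran(S_iⁿ)` is at most one-dimensional: `S_i` is unitary
on it, so orthogonal vectors of the core yield nonzero orthogonal subspaces `N`, `L` of it that are
invariant under `S_i*`, and then the reducing subspace generated by `L` is orthogonal to `N`. If `π`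
is permutative and `S_i` is not pure, the core contains a basis vector, which `S_i` must fix, and by
irreducibility the coding map takes every index to it eventually. For type `P(I)` with `|I| ≥ 2` the
orbit of the distinguished index under the coding map contains no fixed point.
-/

noncomputable section

open Filter Topology
open scoped InnerProductSpace

section VectorStates

variable {A B : Type*} [CStarAlgebra A] [CStarAlgebra B]
variable {H : Type*} [NormedAddCommGroup H] [InnerProductSpace ℂ H] [CompleteSpace H]

theorem vectorState_apply (π : A →⋆ₐ[ℂ] (H →L[ℂ] H)) (x : H) (a : A) :
    vectorState π x a = ⟪x, π a x⟫_ℂ := rfl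

theorem vectorState_star_mul_self (π : A →⋆ₐ[ℂ] (H →L[ℂ] H)) (x : H) (a : A) :
    vectorState π x (star a * a) = ((‖π a x‖ ^ 2 : ℝ) : ℂ) := by
  rw [vectorState_apply, map_mul, map_star, mul_apply_eq_comp,
    ContinuousLinearMap.star_eq_adjoint, ContinuousLinearMap.adjoint_inner_right,
    inner_self_eq_norm_sq_to_K]
  norm_cast

theorem isState_vectorState (π : A →⋆ₐ[ℂ] (H →L[ℂ] H)) {x : H} (hx : ‖x‖ = 1) :
    IsState (vectorState π x) where
  nonneg a := by
    rw [vectorState_star_mul_self]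
    exact_mod_cast sq_nonneg ‖π a x‖
  map_one := by
    rw [vectorState_apply, map_one, one_apply_eq_self, inner_self_eq_norm_sq_to_K, hx]
    norm_num

/-- The Gelfand–Naimark–Segal theorem. -/
theorem IsState.exists_eq_vectorState.{u} {A : Type u} [CStarAlgebra A] {φ : A →ₗ[ℂ] ℂ}
    (hφ : IsState φ) :
    ∃ (K : Type u) (_ : NormedAddCommGroup K) (_ : InnerProductSpace ℂ K) (_ : CompleteSpace K)
      (ρ : A →⋆ₐ[ℂ] (K →L[ℂ] K)) (ξ : K), φ = vectorState ρ ξ := by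
  let _ := CStarAlgebra.spectralOrder A
  have := CStarAlgebra.spectralOrderedRing A
  let f : A →ₚ[ℂ] ℂ := PositiveLinearMap.mk₀ φ fun a ha => by
    obtain ⟨b, rfl⟩ := CStarAlgebra.nonneg_iff_eq_star_mul_self.mp ha
    exact hφ.nonneg b
  refine ⟨f.GNS, inferInstance, inferInstance, inferInstance, f.gnsStarAlgHom,
    ((f.toPreGNS 1 : f.PreGNS) : f.GNS), LinearMap.ext fun a => ?_⟩
  rw [vectorState_apply]
  change _ = ⟪_, f.gnsNonUnitalStarAlgHom a _⟫_ℂ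
  rw [PositiveLinearMap.gnsNonUnitalStarAlgHom_apply_coe, UniformSpace.Completion.inner_coe,
    PositiveLinearMap.preGNS_inner_def]
  simp only [PositiveLinearMap.ofPreGNS_toPreGNS, star_one,
    PositiveLinearMap.leftMulMapPreGNS_apply, mul_one, one_mul, f]
  rfl

theorem IsState.comp {Ω : B →ₗ[ℂ] ℂ} (hΩ : IsState Ω) (f : A →⋆ₐ[ℂ] B) :
    IsState (Ω ∘ₗ f.toAlgHom.toLinearMap) where
  nonneg a := by simpa [map_star f] using hΩ.nonneg (f a)
  map_one := by simpa using hΩ.map_one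

/-- If `Ω` were a proper convex combination, its terms would restrict to `Ω ∘ f` by purity of the
latter. -/
theorem IsState.isPureState_of_isPureState_comp {Ω : B →ₗ[ℂ] ℂ} (hΩ : IsState Ω)
    {f : A →⋆ₐ[ℂ] B} (hpure : IsPureState (Ω ∘ₗ f.toAlgHom.toLinearMap))
    (huniq : ∀ φ, IsState φ → φ ∘ₗ f.toAlgHom.toLinearMap = Ω ∘ₗ f.toAlgHom.toLinearMap → φ = Ω) :
    IsPureState Ω := by
  refine ⟨hΩ, fun φ hφ ψ hψ ⟨s, t, hs, ht, hst, hsum⟩ => huniq φ hφ ?_⟩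
  refine hpure.2 (hφ.comp f) (hψ.comp f) ⟨s, t, hs, ht, hst, ?_⟩
  rw [← hsum]
  rfl

end VectorStates

section Intertwiners

section Orbit

variable {A : Type*} [Ring A] [Algebra ℂ A] [StarRing A]
variable {H K L : Type*} [NormedAddCommGroup H] [InnerProductSpace ℂ H] [CompleteSpace H]
  [NormedAddCommGroup K] [InnerProductSpace ℂ K] [CompleteSpace K]
  [NormedAddCommGroup L] [InnerProductSpace ℂ L] [CompleteSpace L]

/-- The orbit map `a ↦ π(a) x` of a vector `x` under a representation `π`; the vector is cyclic
when this map has dense range. -/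
def orbitMap (π : A →⋆ₐ[ℂ] (H →L[ℂ] H)) (x : H) : A →ₗ[ℂ] H where
  toFun a := π a x
  map_add' a b := by simp
  map_smul' c a := by simp

@[simp]
theorem orbitMap_apply (π : A →⋆ₐ[ℂ] (H →L[ℂ] H)) (x : H) (a : A) : orbitMap π x a = π a x := rfl

/-- The operator `W` intertwines the representations `π` and `ρ`. -/
def Intertwines (π : A →⋆ₐ[ℂ] (H →L[ℂ] H)) (ρ : A →⋆ₐ[ℂ] (K →L[ℂ] K)) (W : H →L[ℂ] K) : Prop :=
  ∀ a, W ∘L π a = ρ a ∘L W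

variable {π : A →⋆ₐ[ℂ] (H →L[ℂ] H)} {ρ : A →⋆ₐ[ℂ] (K →L[ℂ] K)} {τ : A →⋆ₐ[ℂ] (L →L[ℂ] L)}

theorem Intertwines.apply {W : H →L[ℂ] K} (hW : Intertwines π ρ W) (a : A) (v : H) :
    W (π a v) = ρ a (W v) := DFunLike.congr_fun (hW a) v

theorem Intertwines.comp {V : K →L[ℂ] L} {W : H →L[ℂ] K} (hV : Intertwines ρ τ V)
    (hW : Intertwines π ρ W) : Intertwines π τ (V ∘L W) := fun a => by
  rw [ContinuousLinearMap.comp_assoc, hW, ← ContinuousLinearMap.comp_assoc, hV,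
    ContinuousLinearMap.comp_assoc]

theorem Intertwines.adjoint {W : H →L[ℂ] K} (hW : Intertwines π ρ W) :
    Intertwines ρ π W.adjoint := fun a => by
  have h := congrArg ContinuousLinearMap.adjoint (hW (star a))
  rw [ContinuousLinearMap.adjoint_comp, ContinuousLinearMap.adjoint_comp, map_star π, map_star ρ,
    ContinuousLinearMap.star_eq_adjoint, ContinuousLinearMap.star_eq_adjoint,
    ContinuousLinearMap.adjoint_adjoint, ContinuousLinearMap.adjoint_adjoint] at h
  exact h.symm

theorem exists_intertwines_of_norm_le {x : H} (hx : DenseRange (orbitMap π x)) {ξ : K} {C : ℝ}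
    (hC : ∀ a, ‖ρ a ξ‖ ≤ C * ‖π a x‖) : ∃ W : H →L[ℂ] K, W x = ξ ∧ Intertwines π ρ W := by
  let W : H →L[ℂ] K := (orbitMap ρ ξ).extendOfNorm (orbitMap π x)
  have hW (a : A) : W (π a x) = ρ a ξ := LinearMap.extendOfNorm_eq hx ⟨C, hC⟩ a
  refine ⟨W, by simpa using hW 1, fun a => ContinuousLinearMap.ext fun v => ?_⟩
  refine hx.induction_on (p := fun v => (W ∘L π a) v = (ρ a ∘L W) v) v
    (isClosed_eq (by fun_prop) (by fun_prop)) fun b => ?_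
  simpa [hW b] using hW (a * b)

end Orbit

variable {A : Type*} [CStarAlgebra A]
variable {H : Type*} [NormedAddCommGroup H] [InnerProductSpace ℂ H] [CompleteSpace H]

theorem IsIrreducibleRep.denseRange_orbitMap {π : A →⋆ₐ[ℂ] (H →L[ℂ] H)} (hπ : IsIrreducibleRep π)
    {x : H} (hx : x ≠ 0) : DenseRange (orbitMap π x) := by
  have hinv (a : A) : Set.MapsTo (π a) (LinearMap.range (orbitMap π x) : Set H)
      (LinearMap.range (orbitMap π x)) := by
    rintro _ ⟨b, rfl⟩
    exact ⟨a * b, by simp⟩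
  have hmem : x ∈ (LinearMap.range (orbitMap π x)).topologicalClosure :=
    Submodule.le_topologicalClosure _ ⟨1, by simp⟩
  rcases hπ.2 (LinearMap.range (orbitMap π x)).topologicalClosure
    (Submodule.isClosed_topologicalClosure _)
    fun a _ hv => (hinv a).closure (π a).continuous hv with h | h
  · rw [h, Submodule.mem_bot] at hmem
    exact absurd hmem hx
  · exact Submodule.dense_iff_topologicalClosure_eq_top.mpr h

end Intertwiners

section NormalElements

variable {A : Type*} [CStarAlgebra A] {N : A}

theorem cfc_ne_zero_of_mem_spectrum [IsStarNormal N] {f : ℂ → ℂ} (hf : Continuous f) {z : ℂ}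
    (hz : z ∈ spectrum ℂ N) (hfz : f z ≠ 0) : cfc f N ≠ 0 := by
  rw [← cfc_const_zero ℂ N, Ne, cfc_eq_cfc_iff_eqOn]
  exact fun h => hfz (h hz)

theorem exists_spectrum_ne_of_forall_ne_algebraMap [IsStarNormal N]
    (hN : ∀ c : ℂ, N ≠ algebraMap ℂ A c) : ∃ z ∈ spectrum ℂ N, ∃ w ∈ spectrum ℂ N, z ≠ w := by
  have : Nontrivial A := ⟨N, _, hN 0⟩
  obtain ⟨z, hz⟩ := spectrum.nonempty N
  by_contra! h
  exact hN z (CFC.eq_algebraMap_of_spectrum_subset_singleton N z fun w hw => (h z hz w hw).symm)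

/-- The functional calculus is applied to the positive and negative parts of
`u ↦ dist u w - dist u z`, where `z` and `w` are two points of the spectrum. -/
theorem exists_mul_eq_zero_of_forall_ne_algebraMap [IsStarNormal N]
    (hN : ∀ c : ℂ, N ≠ algebraMap ℂ A c) :
    ∃ F G : A, F ≠ 0 ∧ G ≠ 0 ∧ IsSelfAdjoint G ∧ G * F = 0 ∧
      ∀ b, Commute N b → Commute (star N) b → Commute F b ∧ Commute G b := by
  obtain ⟨z, hz, w, hw, hzw⟩ := exists_spectrum_ne_of_forall_ne_algebraMap hN
  let f (u : ℂ) : ℂ := (max (dist u w - dist u z) 0 : ℝ)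
  let g (u : ℂ) : ℂ := (max (dist u z - dist u w) 0 : ℝ)
  have hf : Continuous f := by fun_prop
  have hg : Continuous g := by fun_prop
  have hgf : (fun u => g u * f u) = fun _ => 0 := by
    funext u
    rcases le_total (dist u z) (dist u w) with h | h <;> simp [f, g, h]
  refine ⟨cfc f N, cfc g N, cfc_ne_zero_of_mem_spectrum hf hz ?_,
    cfc_ne_zero_of_mem_spectrum hg hw ?_, ?_, ?_, fun b hb hb' => ⟨hb.cfc hb' f, hb.cfc hb' g⟩⟩
  · simpa [f] using hzw
  · simpa [g, dist_comm] using hzw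
  · rw [IsSelfAdjoint, ← cfc_star]
    simp [g]
  · rw [← cfc_mul g f N, hgf, cfc_const_zero]

end NormalElements

section NormalOperators

variable {M : Type*} [NormedAddCommGroup M] [InnerProductSpace ℂ M] [CompleteSpace M]

/-- For scalar `U` the two spans do; otherwise take the ranges of two functions of `U` with
product zero. -/
theorem exists_orthogonal_invariant_of_isStarNormal (U : M →L[ℂ] M) [IsStarNormal U] {x y : M}
    (hx : x ≠ 0) (hy : y ≠ 0) (hxy : ⟪x, y⟫_ℂ = 0) :
    ∃ N L : Submodule ℂ M, N ≠ ⊥ ∧ L ≠ ⊥ ∧ N ⟂ L ∧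
      (∀ v ∈ N, star U v ∈ N) ∧ ∀ v ∈ L, star U v ∈ L := by
  by_cases hU : ∃ c : ℂ, U = algebraMap ℂ _ c
  · obtain ⟨c, rfl⟩ := hU
    have hinv (P : Submodule ℂ M) : ∀ v ∈ P, star (algebraMap ℂ (M →L[ℂ] M) c) v ∈ P :=
      fun v hv => by
        rw [← algebraMap_star_comm, Algebra.algebraMap_eq_smul_one]
        exact P.smul_mem _ hv
    refine ⟨ℂ ∙ x, ℂ ∙ y, by simpa, by simpa, ?_, hinv _, hinv _⟩
    rw [Submodule.isOrtho_span]
    simpa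
  · obtain ⟨F, G, hF, hG, hGsa, hGF, hcomm⟩ :=
      exists_mul_eq_zero_of_forall_ne_algebraMap (not_exists.mp hU)
    have hstar := hcomm (star U) (star_comm_self' U).symm (Commute.refl _)
    have hinv {B : M →L[ℂ] M} (hB : Commute B (star U)) :
        ∀ v ∈ LinearMap.range B.toLinearMap, star U v ∈ LinearMap.range B.toLinearMap := by
      rintro _ ⟨u, rfl⟩
      exact ⟨star U u, DFunLike.congr_fun hB.eq u⟩
    have hbot {B : M →L[ℂ] M} (hB : B ≠ 0) : LinearMap.range B.toLinearMap ≠ ⊥ := by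
      rw [Ne, LinearMap.range_eq_bot]
      exact fun h => hB (ContinuousLinearMap.coe_injective h)
    refine ⟨_, _, hbot hF, hbot hG, Submodule.isOrtho_iff_inner_eq.mpr ?_, hinv hstar.1,
      hinv hstar.2⟩
    rintro _ ⟨u, rfl⟩ _ ⟨v, rfl⟩
    have hGFu : G (F u) = 0 := DFunLike.congr_fun hGF u
    change ⟪F u, G v⟫_ℂ = 0
    rw [← hGsa.adjoint_eq, ContinuousLinearMap.adjoint_inner_right, hGFu, inner_zero_left]

end NormalOperators

section Schur

variable {A : Type*} [CStarAlgebra A]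
variable {H : Type*} [NormedAddCommGroup H] [InnerProductSpace ℂ H] [CompleteSpace H]
variable {π : A →⋆ₐ[ℂ] (H →L[ℂ] H)}

theorem IsIrreducibleRep.exists_eq_algebraMap (hπ : IsIrreducibleRep π) {N : H →L[ℂ] H}
    (hN : IsSelfAdjoint N) (hc : Intertwines π π N) : ∃ c : ℂ, N = algebraMap ℂ (H →L[ℂ] H) c := by
  by_contra! h
  have := hN.isStarNormal
  obtain ⟨F, G, hF, hG, -, hGF, hcomm⟩ := exists_mul_eq_zero_of_forall_ne_algebraMap h
  have hinv (a : A) (v : H) (hv : v ∈ LinearMap.ker G.toLinearMap) :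
      π a v ∈ LinearMap.ker G.toLinearMap := by
    have hGa : G (π a v) = π a (G v) :=
      DFunLike.congr_fun (hcomm (π a) (hc a) (by rw [hN.star_eq]; exact hc a)).2.eq v
    have hv : G v = 0 := hv
    change G (π a v) = 0
    rw [hGa, hv, map_zero]
  rcases hπ.2 (LinearMap.ker G.toLinearMap) G.isClosed_ker hinv with hker | hker
  · refine hF (ContinuousLinearMap.ext fun v => ?_)
    have hFv : F v ∈ LinearMap.ker G.toLinearMap := DFunLike.congr_fun hGF v
    rwa [hker] at hFv
  · exact hG (ContinuousLinearMap.coe_injective (LinearMap.ker_eq_top.mp hker))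

theorem IsIrreducibleRep.eq_vectorState_of_le (hπ : IsIrreducibleRep π) {x : H} (hx : ‖x‖ = 1)
    {φ : A →ₗ[ℂ] ℂ} (hφ : IsState φ) {C : ℝ} (hC0 : 0 ≤ C)
    (hC : ∀ a, φ (star a * a) ≤ C * vectorState π x (star a * a)) : φ = vectorState π x := by
  obtain ⟨K, _, _, _, ρ, ξ, rfl⟩ := hφ.exists_eq_vectorState
  have hbound (a : A) : ‖ρ a ξ‖ ≤ √C * ‖π a x‖ := by
    have h : ‖ρ a ξ‖ ^ 2 ≤ C * ‖π a x‖ ^ 2 := by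
      have := hC a
      rw [vectorState_star_mul_self, vectorState_star_mul_self] at this
      exact_mod_cast this
    refine le_of_sq_le_sq ?_ (by positivity)
    rwa [mul_pow, Real.sq_sqrt hC0]
  obtain ⟨W, rfl, hW⟩ := exists_intertwines_of_norm_le
    (hπ.denseRange_orbitMap (norm_ne_zero_iff.mp (hx.symm ▸ one_ne_zero))) hbound
  obtain ⟨c, hc⟩ := hπ.exists_eq_algebraMap (N := W.adjoint ∘L W)
    W.isPositive_adjoint_comp_self.isSelfAdjoint (hW.adjoint.comp hW)
  have hscalar (a : A) : vectorState ρ (W x) a = c * vectorState π x a := by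
    have hWW : W.adjoint (W (π a x)) = c • π a x := by
      simpa [Algebra.algebraMap_eq_smul_one] using DFunLike.congr_fun hc (π a x)
    rw [vectorState_apply, vectorState_apply, ← hW.apply, ← ContinuousLinearMap.adjoint_inner_right,
      hWW, inner_smul_right]
  have hc1 : c = 1 := by
    simpa [hφ.map_one, (isState_vectorState π hx).map_one] using (hscalar 1).symm
  exact LinearMap.ext fun a => by rw [hscalar, hc1, one_mul]

theorem IsIrreducibleRep.isPureState_vectorState (hπ : IsIrreducibleRep π) {x : H}
    (hx : ‖x‖ = 1) : IsPureState (vectorState π x) := by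
  refine ⟨isState_vectorState π hx, fun φ hφ ψ hψ ⟨s, t, hs, ht, _, hsum⟩ => ?_⟩
  refine hπ.eq_vectorState_of_le hx hφ (inv_nonneg.mpr hs.le) fun a => ?_
  have hcomb : (s : ℂ) * φ (star a * a) + t * ψ (star a * a) = vectorState π x (star a * a) := by
    simpa using DFunLike.congr_fun hsum (star a * a)
  have ht' : (0 : ℂ) ≤ t := by exact_mod_cast ht.le
  calc φ (star a * a) = (s⁻¹ : ℝ) * (s * φ (star a * a)) := by
        rw [← mul_assoc, ← Complex.ofReal_mul, inv_mul_cancel₀ hs.ne', Complex.ofReal_one, one_mul]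
    _ ≤ (s⁻¹ : ℝ) * vectorState π x (star a * a) := by
        rw [← hcomb]
        refine mul_le_mul_of_nonneg_left (le_add_of_nonneg_right (mul_nonneg ht' (hψ.nonneg a))) ?_
        exact_mod_cast (inv_pos.mpr hs).le

end Schur

section Universal

open scoped CStarAlgebra

variable {X : Type} {R : Set (FreeStarAlg X)}
variable {H K : Type*} [NormedAddCommGroup H] [InnerProductSpace ℂ H] [CompleteSpace H]
  [NormedAddCommGroup K] [InnerProductSpace ℂ K] [CompleteSpace K]

theorem UnivCStar.induction_gen {p : UnivCStar R → Prop} (isClosed : IsClosed {a | p a})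
    (one : p 1) (gen : ∀ x, p (UnivCStar.gen x)) (star_gen : ∀ x, p (star (UnivCStar.gen x)))
    (mul : ∀ a b, p a → p b → p (a * b)) (add : ∀ a b, p a → p b → p (a + b))
    (smul : ∀ (c : ℂ) a, p a → p (c • a)) (a : UnivCStar R) : p a := by
  refine UnivCStar.ind isClosed (fun b => ?_) a
  change p (UnivCStar.coeHom R b)
  induction b using FreeStarAlg.induction' with
  | h1 => rwa [map_one]
  | hl l =>
    rcases l with ⟨x, _ | _⟩
    · exact gen x
    · have hletter : star (FreeStarAlg.gen x) =
          MonoidAlgebra.single (FreeMonoid.of (x, true)) (1 : ℂ) :=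
        FreeStarAlg.star_letter (x, false)
      rw [← hletter, map_star]
      exact star_gen x
  | hm a b ha hb => rw [map_mul]; exact mul _ _ ha hb
  | ha a b ha hb => rw [map_add]; exact add _ _ ha hb
  | hs c a ha => rw [map_smul]; exact smul c _ ha

theorem UnivCStar.apply_mem_of_gen (π : UnivCStar R →⋆ₐ[ℂ] (H →L[ℂ] H)) {P : Submodule ℂ H}
    (hP : IsClosed (P : Set H)) (h : ∀ g, ∀ v ∈ P, π (UnivCStar.gen g) v ∈ P)
    (h' : ∀ g, ∀ v ∈ P, star (π (UnivCStar.gen g)) v ∈ P) (a : UnivCStar R) :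
    ∀ v ∈ P, π a v ∈ P := by
  have hc := map_continuous π
  refine UnivCStar.induction_gen (p := fun a => ∀ v ∈ P, π a v ∈ P) ?_ (by simp) h
    (by simpa only [map_star] using h') (fun a b ha hb v hv => ?_) (fun a b ha hb v hv => ?_)
    (fun c a ha v hv => ?_) a
  · simp only [Set.ofPred_forall]
    exact isClosed_iInter fun v => isClosed_iInter fun _ => hP.preimage (by fun_prop)
  · rw [map_mul]
    exact ha _ (hb v hv)
  · rw [map_add]
    exact P.add_mem (ha v hv) (hb v hv)
  · rw [map_smul]
    exact P.smul_mem c (ha v hv)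

theorem UnivCStar.intertwines_of_gen {π : UnivCStar R →⋆ₐ[ℂ] (H →L[ℂ] H)}
    {ρ : UnivCStar R →⋆ₐ[ℂ] (K →L[ℂ] K)} {W : H →L[ℂ] K}
    (h : ∀ g, W ∘L π (UnivCStar.gen g) = ρ (UnivCStar.gen g) ∘L W)
    (h' : ∀ g, W ∘L star (π (UnivCStar.gen g)) = star (ρ (UnivCStar.gen g)) ∘L W) :
    Intertwines π ρ W := by
  have hπ := map_continuous π
  have hρ := map_continuous ρ
  refine UnivCStar.induction_gen (p := fun a => W ∘L π a = ρ a ∘L W)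
    (isClosed_eq (by fun_prop) (by fun_prop)) (by ext; simp) h
    (by simpa only [map_star] using h') (fun a b ha hb => ?_) (fun a b ha hb => ?_)
    (fun c a ha => ?_)
  · rw [map_mul, map_mul]
    change (W ∘L π a) ∘L π b = ρ a ∘L (ρ b ∘L W)
    rw [ha, ← hb]
    rfl
  · rw [map_add, map_add, ContinuousLinearMap.comp_add, ContinuousLinearMap.add_comp, ha, hb]
  · rw [map_smul, map_smul, ContinuousLinearMap.comp_smul, ContinuousLinearMap.smul_comp, ha]

theorem IsIrreducibleRep.eq_bot_or_orthogonal_eq_bot {π : UnivCStar R →⋆ₐ[ℂ] (H →L[ℂ] H)}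
    (hπ : IsIrreducibleRep π) {P : Submodule ℂ H} (h : ∀ g, ∀ v ∈ P, π (UnivCStar.gen g) v ∈ P)
    (h' : ∀ g, ∀ v ∈ P, star (π (UnivCStar.gen g)) v ∈ P) : P = ⊥ ∨ Pᗮ = ⊥ := by
  have hinv {T : H →L[ℂ] H} (hT : ∀ v ∈ P, T v ∈ P) :
      ∀ v ∈ P.topologicalClosure, T v ∈ P.topologicalClosure := fun _ hv =>
    (show Set.MapsTo T P P from hT).closure T.continuous hv
  have hP := Submodule.isClosed_topologicalClosure P
  rcases hπ.2 _ hP (UnivCStar.apply_mem_of_gen π hP (fun g => hinv (h g)) fun g => hinv (h' g))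
    with hbot | htop
  · exact Or.inl (eq_bot_iff.mpr (hbot ▸ P.le_topologicalClosure))
  · exact Or.inr (P.topologicalClosure_eq_top_iff.mp htop)

end Universal

section PureIsometries

variable {H K : Type*} [NormedAddCommGroup H] [InnerProductSpace ℂ H] [CompleteSpace H]
  [NormedAddCommGroup K] [InnerProductSpace ℂ K] [CompleteSpace K]

theorem isometry_of_star_mul_self {V : H →L[ℂ] H} (hV : star V * V = 1) : Isometry V :=
  V.isometry_iff_adjoint_comp_self.mpr hV

theorem star_pow_mul_pow {R : Type*} [Monoid R] [StarMul R] {s : R} (hs : star s * s = 1) (n : ℕ) :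
    star (s ^ n) * s ^ n = 1 := by
  rw [star_pow, pow_mul_pow_eq_one n hs]

theorem norm_star_pow_le_one {B : Type*} [CStarAlgebra B] {s : B} (hs : star s * s = 1) (n : ℕ) :
    ‖star s ^ n‖ ≤ 1 := by
  rw [← star_pow, norm_star]
  exact norm_le_one_of_isometry (star_pow_mul_pow hs n)

theorem IsPureIsometry.dense_iSup_ker {V : H →L[ℂ] H} (hV : IsPureIsometry V) :
    Dense ((⨆ n : ℕ, (star V ^ (n + 1)).ker : Submodule ℂ H) : Set H) := by
  have horth (n : ℕ) : (star V ^ (n + 1)).kerᗮ = (V ^ (n + 1)).range := by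
    have hclosed : IsClosed ((V ^ (n + 1)).range : Set H) :=
      (isometry_of_star_mul_self (star_pow_mul_pow hV.1 (n + 1))).isClosedEmbedding.isClosed_range
    rw [ContinuousLinearMap.orthogonal_ker, ← ContinuousLinearMap.star_eq_adjoint, ← star_pow,
      star_star, hclosed.submodule_topologicalClosure_eq]
  rw [Submodule.dense_iff_topologicalClosure_eq_top, Submodule.topologicalClosure_eq_top_iff,
    ← Submodule.iInf_orthogonal]
  simp only [horth]
  exact hV.2

theorem IsPureIsometry.tendsto_star_pow {V : H →L[ℂ] H} (hV : IsPureIsometry V) (v : H) :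
    Tendsto (fun n => (star V ^ n) v) atTop (𝓝 0) := by
  have hequi : Equicontinuous fun n (v : H) => (star V ^ n) v :=
    (LipschitzWith.uniformEquicontinuous _ 1 fun n =>
      (star V ^ n).lipschitz.weaken (norm_star_pow_le_one hV.1 n)).equicontinuous
  have hclosed := hequi.isClosed_setOfPred_tendsto (l := atTop) (f := fun _ => 0) continuous_const
  refine hclosed.closure_subset_iff.mpr (fun w hw => ?_) (hV.dense_iSup_ker v)
  refine Submodule.iSup_induction _ hw (motive := fun w => Tendsto (fun n => (star V ^ n) w) atTop
    (𝓝 0)) (fun n w hw => ?_) (by simp) fun w w' hw hw' => by simpa using hw.add hw'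
  refine tendsto_const_nhds.congr' ?_
  filter_upwards [eventually_ge_atTop (n + 1)] with m hm
  obtain ⟨k, rfl⟩ := Nat.exists_eq_add_of_le' hm
  have hw : (star V ^ (n + 1)) w = 0 := hw
  rw [pow_add, mul_apply_eq_comp, hw, map_zero]

theorem IsPureIsometry.eq_zero_of_sandwich {V : H →L[ℂ] H} (hV : IsPureIsometry V)
    {S : K →L[ℂ] K} (hS : star S * S = 1) {D : H →L[ℂ] K} (hD : D = S ∘L D ∘L star V) : D = 0 := by
  have hnorm (n : ℕ) (v : H) : ‖D ((star V ^ n) v)‖ = ‖D v‖ := by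
    induction n with
    | zero => simp
    | succ n ih =>
      rw [← ih, pow_succ', mul_apply_eq_comp]
      conv_rhs => rw [hD]
      exact ((isometry_of_star_mul_self hS).norm_map_of_map_zero (map_zero S) _).symm
  ext v
  have hlim : Tendsto (fun n => ‖D ((star V ^ n) v)‖) atTop (𝓝 0) := by
    simpa using ((D.continuous.tendsto 0).comp (hV.tendsto_star_pow v)).norm
  simp only [hnorm] at hlim
  exact norm_eq_zero.mp (tendsto_nhds_unique tendsto_const_nhds hlim)

end PureIsometries

section CuntzPairs

variable {R : Type*} [Ring R] [StarRing R]

/-- A Cuntz pair: two isometries `a`, `b` with `a a* + b b* = 1`, that is, the images of `S₁`, `S₂`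
under a unital `*`-homomorphism from `O₂`. -/
structure IsCuntzPair (a b : R) : Prop where
  star_left_mul_left : star a * a = 1
  star_right_mul_right : star b * b = 1
  range_add_range : a * star a + b * star b = 1

/-- The map `x ↦ a b* + b x a*`. For a Cuntz pair its fixed points are the solutions of `x b = a`,
`x a = b x`, the relations that the unitary of `Q₂` satisfies with `a = S₁` and `b = S₂`. -/
def adicStep (a b x : R) : R := a * star b + b * x * star a

variable {a b : R}

namespace IsCuntzPair

theorem symm (h : IsCuntzPair a b) : IsCuntzPair b a :=
  ⟨h.star_right_mul_right, h.star_left_mul_left, by rw [add_comm, h.range_add_range]⟩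

theorem map {R' F : Type*} [Ring R'] [StarRing R'] [FunLike F R R'] [RingHomClass F R R']
    [StarHomClass F R R'] (h : IsCuntzPair a b) (f : F) : IsCuntzPair (f a) (f b) where
  star_left_mul_left := by rw [← map_star, ← map_mul, h.star_left_mul_left, map_one]
  star_right_mul_right := by rw [← map_star, ← map_mul, h.star_right_mul_right, map_one]
  range_add_range := by
    rw [← map_star, ← map_star, ← map_mul, ← map_mul, ← map_add, h.range_add_range, map_one]

theorem star_left_mul_right (h : IsCuntzPair a b) : star a * b = 0 := by
  have hsum : star a * b = star a * b + star a * b :=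
    calc star a * b = star a * (a * star a + b * star b) * b := by rw [h.range_add_range, mul_one]
      _ = (star a * a) * (star a * b) + (star a * b) * (star b * b) := by noncomm_ring
      _ = star a * b + star a * b := by
        rw [h.star_left_mul_left, h.star_right_mul_right, one_mul, mul_one]
  exact left_eq_add.mp hsum

theorem isFixedPt_adicStep_iff (h : IsCuntzPair a b) {x : R} :
    Function.IsFixedPt (adicStep a b) x ↔ x * b = a ∧ x * a = b * x := by
  constructor
  · intro hx
    have hx : x = a * star b + b * x * star a := hx.symm
    constructor
    · conv_lhs => rw [hx]
      rw [add_mul, mul_assoc a, h.star_right_mul_right, mul_assoc (b * x), h.star_left_mul_right,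
        mul_one, mul_zero, add_zero]
    · conv_lhs => rw [hx]
      rw [add_mul, mul_assoc a, h.symm.star_left_mul_right, mul_assoc (b * x),
        h.star_left_mul_left, mul_one, mul_zero, zero_add]
  · rintro ⟨hb, ha⟩
    calc a * star b + b * x * star a = x * (a * star a + b * star b) := by
          rw [mul_add, ← mul_assoc, ← mul_assoc, hb, ha, add_comm]
      _ = x := by rw [h.range_add_range, mul_one]

theorem star_adicStep_mul_adicStep (h : IsCuntzPair a b) {x : R} (hx : star x * x = 1) :
    star (adicStep a b x) * adicStep a b x = 1 :=
  calc star (adicStep a b x) * adicStep a b x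
      = b * (star a * a) * star b + b * (star a * b) * x * star a +
        a * star x * (star b * a) * star b + a * (star x * (star b * b) * x) * star a := by
        simp only [adicStep, star_add, star_mul, star_star]
        noncomm_ring
    _ = 1 := by
        rw [h.star_left_mul_left, h.star_left_mul_right, h.symm.star_left_mul_right,
          h.star_right_mul_right, mul_one (star x), hx, mul_one, mul_one, mul_zero, mul_zero,
          zero_mul, zero_mul, zero_mul, add_zero, add_zero, add_comm, h.range_add_range]

end IsCuntzPair

theorem star_adicStep (a b x : R) : star (adicStep a b x) = adicStep b a (star x) := by
  simp only [adicStep, star_add, star_mul, star_star, mul_assoc]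

theorem map_adicStep {R' F : Type*} [Ring R'] [StarRing R'] [FunLike F R R'] [RingHomClass F R R']
    [StarHomClass F R R'] (f : F) (a b x : R) :
    f (adicStep a b x) = adicStep (f a) (f b) (f x) := by
  simp only [adicStep, map_add, map_mul, map_star]

theorem iterate_adicStep_sub (a b x y : R) (n : ℕ) :
    (adicStep a b)^[n] x - (adicStep a b)^[n] y = b ^ n * (x - y) * star a ^ n := by
  induction n with
  | zero => simp
  | succ n ih =>
    rw [Function.iterate_succ_apply', Function.iterate_succ_apply']
    calc adicStep a b ((adicStep a b)^[n] x) - adicStep a b ((adicStep a b)^[n] y)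
        = b * ((adicStep a b)^[n] x - (adicStep a b)^[n] y) * star a := by
          rw [adicStep, adicStep]
          noncomm_ring
      _ = b ^ (n + 1) * (x - y) * star a ^ (n + 1) := by
          rw [ih, pow_succ' b, pow_succ (star a)]
          simp only [mul_assoc]

end CuntzPairs

section PureCuntzPairs

variable {H K : Type*} [NormedAddCommGroup H] [InnerProductSpace ℂ H] [CompleteSpace H]
  [NormedAddCommGroup K] [InnerProductSpace ℂ K] [CompleteSpace K]

/-- The defect `u' W - W u` is carried to itself by `D ↦ b' D a*`. -/
theorem IsPureIsometry.comp_eq_comp_of_isFixedPt_adicStep {a b u : H →L[ℂ] H} {a' b' u' : K →L[ℂ] K}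
    (ha : IsPureIsometry a) (hb' : star b' * b' = 1) (hu : Function.IsFixedPt (adicStep a b) u)
    (hu' : Function.IsFixedPt (adicStep a' b') u') {W : H →L[ℂ] K} (hWa : W ∘L a = a' ∘L W)
    (hWb : W ∘L b = b' ∘L W) (hWa' : W ∘L star a = star a' ∘L W)
    (hWb' : W ∘L star b = star b' ∘L W) : W ∘L u = u' ∘L W := by
  refine (sub_eq_zero.mp (ha.eq_zero_of_sandwich hb' ?_)).symm
  ext v
  have hWa (w : H) : W (a w) = a' (W w) := DFunLike.congr_fun hWa w
  have hWb (w : H) : W (b w) = b' (W w) := DFunLike.congr_fun hWb w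
  have hWa' : W (star a v) = star a' (W v) := DFunLike.congr_fun hWa' v
  have hWb' : W (star b v) = star b' (W v) := DFunLike.congr_fun hWb' v
  have huv : u v = a (star b v) + b (u (star a v)) := DFunLike.congr_fun hu.symm v
  have hu'v : u' (W v) = a' (star b' (W v)) + b' (u' (star a' (W v))) :=
    DFunLike.congr_fun hu'.symm (W v)
  change u' (W v) - W (u v) = b' (u' (W (star a v)) - W (u (star a v)))
  rw [huv, hu'v, map_add, hWa, hWb, hWa', hWb', map_sub]
  abel

namespace IsCuntzPair

variable {a b : H →L[ℂ] H}

theorem star_iterate_adicStep_mul (h : IsCuntzPair a b) (n : ℕ) :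
    star ((adicStep a b)^[n] 1) * (adicStep a b)^[n] 1 = 1 := by
  induction n with
  | zero => simp
  | succ n ih =>
    rw [Function.iterate_succ_apply']
    exact h.star_adicStep_mul_adicStep ih

theorem norm_iterate_adicStep_apply (h : IsCuntzPair a b) (n : ℕ) (v : H) :
    ‖((adicStep a b)^[n] 1) v‖ = ‖v‖ :=
  (ContinuousLinearMap.norm_map_iff_adjoint_comp_self _).mpr (h.star_iterate_adicStep_mul n) v

theorem cauchySeq_iterate_adicStep_apply (h : IsCuntzPair a b) (ha : IsPureIsometry a) (v : H) :
    CauchySeq fun n => ((adicStep a b)^[n] 1) v := by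
  refine cauchySeq_of_le_tendsto_0' (fun n => 2 * ‖(star a ^ n) v‖) (fun n m hnm => ?_)
    (by simpa using (ha.tendsto_star_pow v).norm.const_mul 2)
  obtain ⟨k, rfl⟩ := Nat.exists_eq_add_of_le hnm
  have hdiff := DFunLike.congr_fun (iterate_adicStep_sub a b 1 ((adicStep a b)^[k] 1) n) v
  rw [← Function.iterate_add_apply] at hdiff
  have hiso := isometry_of_star_mul_self (star_pow_mul_pow h.star_right_mul_right n)
  set w := (star a ^ n) v
  calc dist (((adicStep a b)^[n] 1) v) (((adicStep a b)^[n + k] 1) v)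
      = ‖(b ^ n) (w - ((adicStep a b)^[k] 1) w)‖ := by
        rw [dist_eq_norm]
        exact congrArg norm hdiff
    _ = ‖w - ((adicStep a b)^[k] 1) w‖ := hiso.norm_map_of_map_zero (map_zero _) _
    _ ≤ ‖w‖ + ‖((adicStep a b)^[k] 1) w‖ := norm_sub_le _ _
    _ = 2 * ‖w‖ := by rw [h.norm_iterate_adicStep_apply, two_mul]

theorem exists_isometry_isFixedPt_adicStep (h : IsCuntzPair a b) (ha : IsPureIsometry a) :
    ∃ u : H →L[ℂ] H, star u * u = 1 ∧ Function.IsFixedPt (adicStep a b) u := by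
  choose f hf using fun v => cauchySeq_tendsto_of_complete (h.cauchySeq_iterate_adicStep_apply ha v)
  let u : H →L[ℂ] H := continuousLinearMapOfTendsto _ (tendsto_pi_nhds.mpr hf)
  have hu (v : H) : Tendsto (fun n => ((adicStep a b)^[n] 1) v) atTop (𝓝 (u v)) := hf v
  have hnorm (v : H) : ‖u v‖ = ‖v‖ :=
    tendsto_nhds_unique (hu v).norm
      (by simpa only [h.norm_iterate_adicStep_apply] using tendsto_const_nhds)
  refine ⟨u, (ContinuousLinearMap.norm_map_iff_adjoint_comp_self u).mp hnorm,
    ContinuousLinearMap.ext fun v => ?_⟩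
  refine tendsto_nhds_unique ?_ ((tendsto_add_atTop_iff_nat 1).mpr (hu v))
  simp only [Function.iterate_succ_apply']
  exact tendsto_const_nhds.add ((b.continuous.tendsto _).comp (hu (star a v)))

theorem exists_unitary_isFixedPt_adicStep (h : IsCuntzPair a b) (ha : IsPureIsometry a)
    (hb : IsPureIsometry b) : ∃ u : H →L[ℂ] H, star u * u = 1 ∧ u * star u = 1 ∧
      Function.IsFixedPt (adicStep a b) u := by
  obtain ⟨u, hu, hfix⟩ := h.exists_isometry_isFixedPt_adicStep ha
  obtain ⟨w, hw, hfix'⟩ := h.symm.exists_isometry_isFixedPt_adicStep hb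
  have hstar : Function.IsFixedPt (adicStep b a) (star u) := by
    rw [Function.IsFixedPt, ← star_adicStep, hfix.eq]
  have huw : star u = w :=
    hb.comp_eq_comp_of_isFixedPt_adicStep h.star_left_mul_left hstar hfix'
      (W := ContinuousLinearMap.id ℂ H) rfl rfl rfl rfl
  refine ⟨u, hu, ?_, hfix⟩
  rwa [← huw, star_star] at hw

end IsCuntzPair

end PureCuntzPairs

section UniqueExtension

theorem O2.isCuntzPair_S : IsCuntzPair (O2.S 0) (O2.S 1) :=
  ⟨O2.isometry_S 0, O2.isometry_S 1, O2.range_S⟩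

theorem O2.incl_S_zero : O2.incl (O2.S 0) = Q2.U * Q2.S₂ := O2.lift_S _ _ _ 0

theorem O2.incl_S_one : O2.incl (O2.S 1) = Q2.S₂ := O2.lift_S _ _ _ 1

theorem Q2.isFixedPt_adicStep_U :
    Function.IsFixedPt (adicStep (O2.incl (O2.S 0)) (O2.incl (O2.S 1))) Q2.U := by
  rw [(O2.isCuntzPair_S.map O2.incl).isFixedPt_adicStep_iff, O2.incl_S_zero, O2.incl_S_one,
    Q2.S₂_mul_U, pow_two, mul_assoc]
  exact ⟨rfl, rfl⟩

variable {H K : Type*} [NormedAddCommGroup H] [InnerProductSpace ℂ H] [CompleteSpace H]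
  [NormedAddCommGroup K] [InnerProductSpace ℂ K] [CompleteSpace K]

theorem O2.exists_comp_incl_eq_of_pure (π : O2 →⋆ₐ[ℂ] (H →L[ℂ] H))
    (hp : ∀ i, IsPureIsometry (π (O2.S i))) :
    ∃ π' : Q2 →⋆ₐ[ℂ] (H →L[ℂ] H), π'.comp O2.incl = π := by
  have h := O2.isCuntzPair_S.map π
  obtain ⟨u, hu, hu', hfix⟩ := h.exists_unitary_isFixedPt_adicStep (hp 0) (hp 1)
  obtain ⟨hub, hua⟩ := h.isFixedPt_adicStep_iff.mp hfix
  refine ⟨Q2.lift u (π (O2.S 1)) hu hu' (hp 1).1 (by rw [← hua, pow_two, mul_assoc, hub])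
    (by rw [mul_assoc (u * _), ← star_mul, hub, add_comm, h.range_add_range]), ?_⟩
  refine O2.hom_ext (Fin.forall_fin_two.mpr ⟨?_, ?_⟩)
  · rw [StarAlgHom.comp_apply, O2.incl_S_zero, map_mul, Q2.lift_U, Q2.lift_S₂, hub]
  · rw [StarAlgHom.comp_apply, O2.incl_S_one, Q2.lift_S₂]

variable {π : Q2 →⋆ₐ[ℂ] (H →L[ℂ] H)} {ρ : Q2 →⋆ₐ[ℂ] (K →L[ℂ] K)}

theorem Q2.intertwines_of_comp_incl (hp : IsPureIsometry (π (O2.incl (O2.S 0)))) {W : H →L[ℂ] K}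
    (hW : Intertwines (π.comp O2.incl) (ρ.comp O2.incl) W) : Intertwines π ρ W := by
  have hS (i : Fin 2) : W ∘L π (O2.incl (O2.S i)) = ρ (O2.incl (O2.S i)) ∘L W := hW (O2.S i)
  have hS' (i : Fin 2) :
      W ∘L star (π (O2.incl (O2.S i))) = star (ρ (O2.incl (O2.S i))) ∘L W := by
    rw [← map_star π, ← map_star ρ, ← map_star O2.incl]
    exact hW (star (O2.S i))
  have hU : W ∘L π Q2.U = ρ Q2.U ∘L W :=
    hp.comp_eq_comp_of_isFixedPt_adicStep
      ((O2.isCuntzPair_S.map O2.incl).map ρ).star_right_mul_right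
      (by rw [Function.IsFixedPt, ← map_adicStep, Q2.isFixedPt_adicStep_U])
      (by rw [Function.IsFixedPt, ← map_adicStep, Q2.isFixedPt_adicStep_U])
      (hS 0) (hS 1) (hS' 0) (hS' 1)
  have hU' : W ∘L star (π Q2.U) = star (ρ Q2.U) ∘L W := by
    have hπU : π Q2.U * star (π Q2.U) = 1 := by rw [← map_star, ← map_mul, Q2.U_mul_star_U, map_one]
    have hρU : star (ρ Q2.U) * ρ Q2.U = 1 := by rw [← map_star, ← map_mul, Q2.star_U_mul_U, map_one]
    calc W ∘L star (π Q2.U) = (star (ρ Q2.U) * ρ Q2.U) ∘L W ∘L star (π Q2.U) := by rw [hρU]; rfl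
      _ = star (ρ Q2.U) ∘L (ρ Q2.U ∘L W) ∘L star (π Q2.U) := rfl
      _ = star (ρ Q2.U) ∘L W ∘L (π Q2.U * star (π Q2.U)) := by rw [← hU]; rfl
      _ = star (ρ Q2.U) ∘L W := by rw [hπU]; rfl
  have hS₂ : W ∘L π Q2.S₂ = ρ Q2.S₂ ∘L W := by
    rw [← O2.incl_S_one]
    exact hS 1
  have hS₂' : W ∘L star (π Q2.S₂) = star (ρ Q2.S₂) ∘L W := by
    rw [← O2.incl_S_one]
    exact hS' 1
  refine UnivCStar.intertwines_of_gen ?_ ?_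
  · rintro (_ | _)
    exacts [hU, hS₂]
  · rintro (_ | _)
    exacts [hU', hS₂']

theorem Q2.eq_vectorState_of_comp_incl_eq {x : H} (hx : DenseRange (orbitMap (π.comp O2.incl) x))
    (hp : IsPureIsometry (π (O2.incl (O2.S 0)))) {Ω : Q2 →ₗ[ℂ] ℂ} (hΩ : IsState Ω)
    (h : Ω ∘ₗ O2.incl.toAlgHom.toLinearMap = vectorState (π.comp O2.incl) x) :
    Ω = vectorState π x := by
  obtain ⟨K, _, _, _, ρ, ξ, rfl⟩ := hΩ.exists_eq_vectorState
  have hval (a : O2) : vectorState (ρ.comp O2.incl) ξ a = vectorState (π.comp O2.incl) x a :=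
    DFunLike.congr_fun h a
  have hnorm (a : O2) : ‖ρ.comp O2.incl a ξ‖ = ‖π.comp O2.incl a x‖ := by
    have hsq := hval (star a * a)
    rw [vectorState_star_mul_self, vectorState_star_mul_self, Complex.ofReal_inj] at hsq
    exact (sq_eq_sq₀ (norm_nonneg _) (norm_nonneg _)).mp hsq
  obtain ⟨W, rfl, hW⟩ := exists_intertwines_of_norm_le hx (C := 1)
    fun a => by rw [one_mul, hnorm]
  have hinner (v : H) : ⟪W x, W v⟫_ℂ = ⟪x, v⟫_ℂ := by
    refine hx.induction_on (p := fun v => ⟪W x, W v⟫_ℂ = ⟪x, v⟫_ℂ) v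
      (isClosed_eq (by fun_prop) (by fun_prop)) fun a => ?_
    rw [orbitMap_apply, hW.apply]
    exact hval a
  ext a
  rw [vectorState_apply, vectorState_apply, ← (Q2.intertwines_of_comp_incl hp hW).apply, hinner]

theorem IsIrreducibleRep.hasUniquePureExtension_vectorState {π : O2 →⋆ₐ[ℂ] (H →L[ℂ] H)}
    (hπ : IsIrreducibleRep π) (hp : ∀ i, IsPureIsometry (π (O2.S i))) {x : H} (hx : ‖x‖ = 1) :
    HasUniquePureExtension (vectorState π x) := by
  have hpure := hπ.isPureState_vectorState hx
  have hcyclic := hπ.denseRange_orbitMap (norm_ne_zero_iff.mp (hx.symm ▸ one_ne_zero))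
  obtain ⟨π', rfl⟩ := O2.exists_comp_incl_eq_of_pure π hp
  have huniq (Ω : Q2 →ₗ[ℂ] ℂ) (hΩ : IsState Ω)
      (h : Ω ∘ₗ O2.incl.toAlgHom.toLinearMap = vectorState (π'.comp O2.incl) x) :
      Ω = vectorState π' x := Q2.eq_vectorState_of_comp_incl_eq hcyclic (hp 0) hΩ h
  exact ⟨hpure, vectorState π' x,
    ⟨(isState_vectorState π' hx).isPureState_of_isPureState_comp hpure huniq, rfl⟩,
    fun Ω hΩ => huniq Ω hΩ.1.1 hΩ.2⟩

end UniqueExtension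

section CoreRange

variable {H : Type*} [NormedAddCommGroup H] [InnerProductSpace ℂ H]

/-- The intersection of the ranges of the powers of `V`. For an isometry `V` it is the unitary
summand of the Wold decomposition, and it vanishes exactly when `V` is pure. -/
def coreRange (V : H →L[ℂ] H) : Submodule ℂ H :=
  ⨅ n : ℕ, LinearMap.range ((V ^ (n + 1) : H →L[ℂ] H) : H →ₗ[ℂ] H)

theorem mem_coreRange {V : H →L[ℂ] H} {v : H} :
    v ∈ coreRange V ↔ ∀ n : ℕ, ∃ w, (V ^ (n + 1)) w = v := by
  simp only [coreRange, Submodule.mem_iInf, LinearMap.mem_range, ContinuousLinearMap.coe_coe]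

theorem apply_mem_coreRange {V : H →L[ℂ] H} {v : H} (hv : v ∈ coreRange V) :
    V v ∈ coreRange V := by
  refine mem_coreRange.mpr fun n => ?_
  obtain ⟨w, rfl⟩ := mem_coreRange.mp hv n
  exact ⟨V w, by rw [← mul_apply_eq_comp, ← mul_apply_eq_comp, ← pow_succ, pow_succ']⟩

variable [CompleteSpace H] {V : H →L[ℂ] H}

theorem star_apply_apply_of_star_mul_self (hV : star V * V = 1) (v : H) : star V (V v) = v :=
  DFunLike.congr_fun hV v

theorem isClosed_coreRange (hV : star V * V = 1) : IsClosed (coreRange V : Set H) := by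
  rw [coreRange, Submodule.coe_iInf]
  exact isClosed_iInter fun n =>
    (isometry_of_star_mul_self (star_pow_mul_pow hV (n + 1))).isClosedEmbedding.isClosed_range

theorem star_apply_mem_coreRange (hV : star V * V = 1) {v : H} (hv : v ∈ coreRange V) :
    star V v ∈ coreRange V := by
  refine mem_coreRange.mpr fun n => ?_
  obtain ⟨w, rfl⟩ := mem_coreRange.mp hv (n + 1)
  exact ⟨w, by rw [pow_succ' V (n + 1), mul_apply_eq_comp, star_apply_apply_of_star_mul_self hV]⟩

theorem apply_star_apply_of_mem_coreRange (hV : star V * V = 1) {v : H} (hv : v ∈ coreRange V) :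
    V (star V v) = v := by
  obtain ⟨w, rfl⟩ := mem_coreRange.mp hv 0
  rw [zero_add, pow_one, star_apply_apply_of_star_mul_self hV]

/-- The operator that `V` induces on the intersection of the ranges of its powers. -/
def coreRestrict (V : H →L[ℂ] H) : coreRange V →L[ℂ] coreRange V :=
  V.restrict fun _ => apply_mem_coreRange

theorem coe_star_coreRestrict_apply (hV : star V * V = 1) [CompleteSpace (coreRange V)]
    (v : coreRange V) : (star (coreRestrict V) v : H) = star V v := by
  suffices h : star (coreRestrict V) v = ⟨star V v, star_apply_mem_coreRange hV v.2⟩ from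
    congrArg Subtype.val h
  refine ext_inner_right ℂ fun w => ?_
  rw [ContinuousLinearMap.star_eq_adjoint, ContinuousLinearMap.adjoint_inner_left]
  exact (V.adjoint_inner_left (w : H) (v : H)).symm

theorem isStarNormal_coreRestrict (hV : star V * V = 1) [CompleteSpace (coreRange V)] :
    IsStarNormal (coreRestrict V) where
  star_comm_self := by
    ext v
    change (star (coreRestrict V) (coreRestrict V v) : H) = V (star (coreRestrict V) v : H)
    rw [coe_star_coreRestrict_apply hV, coe_star_coreRestrict_apply hV,
      apply_star_apply_of_mem_coreRange hV v.2]
    exact star_apply_apply_of_star_mul_self hV _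

theorem exists_orthogonal_star_invariant_le_coreRange (hV : star V * V = 1) {x y : H}
    (hx : x ∈ coreRange V) (hy : y ∈ coreRange V) (hx₀ : x ≠ 0) (hy₀ : y ≠ 0)
    (hxy : ⟪x, y⟫_ℂ = 0) :
    ∃ N L : Submodule ℂ H, N ≠ ⊥ ∧ L ≠ ⊥ ∧ N ≤ coreRange V ∧ L ≤ coreRange V ∧ N ⟂ L ∧
      (∀ v ∈ N, star V v ∈ N) ∧ ∀ v ∈ L, star V v ∈ L := by
  have : CompleteSpace (coreRange V) := (isClosed_coreRange hV).completeSpace_coe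
  have := isStarNormal_coreRestrict hV
  obtain ⟨N, L, hN, hL, hNL, hNinv, hLinv⟩ := exists_orthogonal_invariant_of_isStarNormal
    (coreRestrict V) (x := ⟨x, hx⟩) (y := ⟨y, hy⟩) (by simpa using hx₀) (by simpa using hy₀) hxy
  have hbot {P : Submodule ℂ (coreRange V)} (hP : P ≠ ⊥) : P.map (coreRange V).subtype ≠ ⊥ :=
    fun h => hP (Submodule.map_injective_of_injective (coreRange V).injective_subtype
      (h.trans (Submodule.map_bot _).symm))
  have hinv {P : Submodule ℂ (coreRange V)} (hP : ∀ v ∈ P, star (coreRestrict V) v ∈ P) :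
      ∀ v ∈ P.map (coreRange V).subtype, star V v ∈ P.map (coreRange V).subtype := by
    rintro _ ⟨v, hv, rfl⟩
    exact ⟨_, hP v hv, coe_star_coreRestrict_apply hV v⟩
  exact ⟨_, _, hbot hN, hbot hL, Submodule.map_subtype_le _ _, Submodule.map_subtype_le _ _,
    hNL.map (coreRange V).subtypeₗᵢ, hinv hNinv, hinv hLinv⟩

end CoreRange

section CoreOfIrreducible

variable {H : Type*} [NormedAddCommGroup H] [InnerProductSpace ℂ H] [CompleteSpace H]
  {π : O2 →⋆ₐ[ℂ] (H →L[ℂ] H)}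

theorem O2.map_word_nil_apply (π : O2 →⋆ₐ[ℂ] (H →L[ℂ] H)) (v : H) : π (O2.word []) v = v := by
  rw [O2.word, List.map_nil, List.prod_nil, map_one, one_apply_eq_self]

theorem O2.map_word_cons_apply (π : O2 →⋆ₐ[ℂ] (H →L[ℂ] H)) (j : Fin 2) (w : List (Fin 2)) (v : H) :
    π (O2.word (j :: w)) v = π (O2.S j) (π (O2.word w) v) := by
  rw [O2.word, List.map_cons, List.prod_cons, map_mul, mul_apply_eq_comp, O2.word]

theorem O2.star_map_S_mul_map_S (π : O2 →⋆ₐ[ℂ] (H →L[ℂ] H)) (i : Fin 2) :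
    star (π (O2.S i)) * π (O2.S i) = 1 := by
  rw [← map_star, ← map_mul, O2.isometry_S, map_one]

theorem O2.star_map_S_apply_map_S (π : O2 →⋆ₐ[ℂ] (H →L[ℂ] H)) (j k : Fin 2) (v : H) :
    star (π (O2.S j)) (π (O2.S k) v) = if j = k then v else 0 := by
  have h := O2.isCuntzPair_S.map π
  have hmul : star (π (O2.S j)) * π (O2.S k) = if j = k then 1 else 0 := by
    fin_cases j <;> fin_cases k
    exacts [h.star_left_mul_left, h.star_left_mul_right, h.symm.star_left_mul_right,
      h.star_right_mul_right]
  rw [← mul_apply_eq_comp, hmul]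
  split_ifs <;> rfl

theorem O2.star_map_S_apply_of_mem_coreRange {i j : Fin 2} (hij : j ≠ i) {v : H}
    (hv : v ∈ coreRange (π (O2.S i))) : star (π (O2.S j)) v = 0 := by
  rw [← apply_star_apply_of_mem_coreRange (O2.star_map_S_mul_map_S π i) hv,
    O2.star_map_S_apply_map_S, if_neg hij]

theorem O2.star_map_S_apply_mem {i : Fin 2} {N : Submodule ℂ H} (hN : N ≤ coreRange (π (O2.S i)))
    (hNinv : ∀ v ∈ N, star (π (O2.S i)) v ∈ N) (j : Fin 2) {v : H} (hv : v ∈ N) :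
    star (π (O2.S j)) v ∈ N := by
  by_cases hj : j = i
  · exact hj ▸ hNinv v hv
  · exact (O2.star_map_S_apply_of_mem_coreRange hj (hN hv)).symm ▸ N.zero_mem

/-- The span of all `S_w L`; it reduces `π` once `L` is invariant under `S₁*` and `S₂*`. -/
def wordSpan (π : O2 →⋆ₐ[ℂ] (H →L[ℂ] H)) (L : Submodule ℂ H) : Submodule ℂ H :=
  ⨆ w : List (Fin 2), L.map (π (O2.word w) : H →ₗ[ℂ] H)

theorem map_word_apply_mem_wordSpan {L : Submodule ℂ H} {v : H} (hv : v ∈ L) (w : List (Fin 2)) :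
    π (O2.word w) v ∈ wordSpan π L :=
  Submodule.mem_iSup_of_mem w (Submodule.mem_map_of_mem hv)

theorem le_wordSpan {L : Submodule ℂ H} : L ≤ wordSpan π L := fun v hv => by
  simpa only [O2.map_word_nil_apply] using map_word_apply_mem_wordSpan (π := π) hv []

theorem wordSpan_le {L P : Submodule ℂ H} (h : ∀ w, ∀ v ∈ L, π (O2.word w) v ∈ P) :
    wordSpan π L ≤ P :=
  iSup_le fun w => Submodule.map_le_iff_le_comap.mpr (h w)

theorem map_S_apply_mem_wordSpan {L : Submodule ℂ H} (j : Fin 2) {v : H} (hv : v ∈ wordSpan π L) :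
    π (O2.S j) v ∈ wordSpan π L := by
  refine wordSpan_le (P := (wordSpan π L).comap (π (O2.S j) : H →ₗ[ℂ] H)) (fun w u hu => ?_) hv
  change π (O2.S j) (π (O2.word w) u) ∈ wordSpan π L
  rw [← O2.map_word_cons_apply]
  exact map_word_apply_mem_wordSpan hu _

theorem star_map_S_apply_mem_wordSpan {L : Submodule ℂ H}
    (hL : ∀ j, ∀ v ∈ L, star (π (O2.S j)) v ∈ L) (j : Fin 2) {v : H} (hv : v ∈ wordSpan π L) :
    star (π (O2.S j)) v ∈ wordSpan π L := by
  refine wordSpan_le (P := (wordSpan π L).comap (star (π (O2.S j)) : H →L[ℂ] H).toLinearMap)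
    (fun w u hu => ?_) hv
  change star (π (O2.S j)) (π (O2.word w) u) ∈ wordSpan π L
  cases w with
  | nil =>
    rw [O2.map_word_nil_apply]
    exact le_wordSpan (hL j u hu)
  | cons k w =>
    rw [O2.map_word_cons_apply, O2.star_map_S_apply_map_S]
    split_ifs
    exacts [map_word_apply_mem_wordSpan hu w, zero_mem _]

theorem isOrtho_wordSpan {N L : Submodule ℂ H} (hN : ∀ j, ∀ v ∈ N, star (π (O2.S j)) v ∈ N)
    (hNL : N ⟂ L) : N ⟂ wordSpan π L := by
  rw [Submodule.isOrtho_comm, Submodule.isOrtho_iff_le]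
  refine wordSpan_le fun w y hy => (Submodule.mem_orthogonal _ _).mpr ?_
  induction w with
  | nil =>
    intro x hx
    rw [O2.map_word_nil_apply]
    exact hNL.inner_eq hx hy
  | cons j w ih =>
    intro x hx
    rw [O2.map_word_cons_apply, ← ContinuousLinearMap.adjoint_inner_left]
    exact ih _ (hN j x hx)

theorem IsIrreducibleRep.eq_bot_or_eq_bot_of_isOrtho (hπ : IsIrreducibleRep π)
    {N L : Submodule ℂ H} (hN : ∀ j, ∀ v ∈ N, star (π (O2.S j)) v ∈ N)
    (hL : ∀ j, ∀ v ∈ L, star (π (O2.S j)) v ∈ L) (hNL : N ⟂ L) : N = ⊥ ∨ L = ⊥ := by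
  rcases hπ.eq_bot_or_orthogonal_eq_bot (fun j _ => map_S_apply_mem_wordSpan (L := L) j)
    (fun j _ => star_map_S_apply_mem_wordSpan hL j) with h | h
  · exact Or.inr (eq_bot_iff.mpr (h ▸ le_wordSpan))
  · exact Or.inl (eq_bot_iff.mpr (h ▸ Submodule.isOrtho_iff_le.mp (isOrtho_wordSpan hN hNL)))

theorem IsIrreducibleRep.eq_zero_or_eq_zero_of_mem_coreRange (hπ : IsIrreducibleRep π) {i : Fin 2}
    {x y : H} (hx : x ∈ coreRange (π (O2.S i))) (hy : y ∈ coreRange (π (O2.S i)))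
    (hxy : ⟪x, y⟫_ℂ = 0) : x = 0 ∨ y = 0 := by
  by_contra! h
  obtain ⟨N, L, hN₀, hL₀, hN, hL, hNL, hNinv, hLinv⟩ :=
    exists_orthogonal_star_invariant_le_coreRange (O2.star_map_S_mul_map_S π i) hx hy h.1 h.2 hxy
  exact (hπ.eq_bot_or_eq_bot_of_isOrtho (fun j _ => O2.star_map_S_apply_mem hN hNinv j)
    (fun j _ => O2.star_map_S_apply_mem hL hLinv j) hNL).elim hN₀ hL₀

end CoreOfIrreducible

section Permutative

variable {H : Type*} [NormedAddCommGroup H] [InnerProductSpace ℂ H] [CompleteSpace H]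

namespace IsPermutative

variable {π : O2 →⋆ₐ[ℂ] (H →L[ℂ] H)} {e : HilbertBasis ℕ ℂ H} {σ : Fin 2 → ℕ → ℕ}

theorem bijective (h : IsPermutative π e σ) :
    Function.Bijective fun p : Fin 2 × ℕ => σ p.1 p.2 := by
  have hne (m n : ℕ) : σ 0 m ≠ σ 1 n := fun hmn =>
    Set.disjoint_left.mp h.disjoint ⟨m, rfl⟩ ⟨n, hmn.symm⟩
  constructor
  · rintro ⟨i, m⟩ ⟨j, n⟩ hmn
    fin_cases i <;> fin_cases j
    exacts [congrArg _ (h.injective 0 hmn), absurd hmn (hne m n), absurd hmn.symm (hne n m),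
      congrArg _ (h.injective 1 hmn)]
  · intro n
    rcases h.union.ge (Set.mem_univ n) with ⟨m, hm⟩ | ⟨m, hm⟩
    exacts [⟨(0, m), hm⟩, ⟨(1, m), hm⟩]

/-- The coding map of the branching function system: the common left inverse of the branches
`σ 0` and `σ 1`. -/
def shift (h : IsPermutative π e σ) (n : ℕ) : ℕ := ((Equiv.ofBijective _ h.bijective).symm n).2

theorem shift_branch (h : IsPermutative π e σ) (j : Fin 2) (n : ℕ) : h.shift (σ j n) = n :=
  congrArg Prod.snd ((Equiv.ofBijective _ h.bijective).symm_apply_apply (j, n))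

theorem iterate_shift_foldr (h : IsPermutative π e σ) (w : List (Fin 2)) (n : ℕ) :
    h.shift^[w.length] (w.foldr σ n) = n := by
  induction w with
  | nil => rfl
  | cons j w ih =>
    rw [List.length_cons, List.foldr_cons, Function.iterate_succ_apply, h.shift_branch, ih]

theorem map_word_apply (h : IsPermutative π e σ) (w : List (Fin 2)) (n : ℕ) :
    π (O2.word w) (e n) = e (w.foldr σ n) := by
  induction w with
  | nil => exact O2.map_word_nil_apply π _
  | cons j w ih => rw [O2.map_word_cons_apply, ih, h.map_S, List.foldr_cons]

theorem star_map_S_apply (h : IsPermutative π e σ) (j : Fin 2) (n : ℕ) :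
    star (π (O2.S j)) (e n) = if σ j (h.shift n) = n then e (h.shift n) else 0 := by
  obtain ⟨⟨k, m⟩, rfl⟩ := h.bijective.2 n
  have hjk : σ j m = σ k m ↔ j = k :=
    (h.bijective.1.eq_iff (a := (j, m)) (b := (k, m))).trans
      (by rw [Prod.mk.injEq, and_iff_left rfl])
  simp only [← h.map_S, O2.star_map_S_apply_map_S, h.shift_branch, hjk]

theorem star_map_word_apply (h : IsPermutative π e σ) (w : List (Fin 2)) (n : ℕ) :
    star (π (O2.word w)) (e n) =
      if w.foldr σ (h.shift^[w.length] n) = n then e (h.shift^[w.length] n) else 0 := by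
  induction w generalizing n with
  | nil => simp [O2.word]
  | cons j w ih =>
    have hcons : star (π (O2.word (j :: w))) (e n) =
        star (π (O2.word w)) (star (π (O2.S j)) (e n)) := by
      rw [← mul_apply_eq_comp, ← star_mul, ← map_mul]
      rfl
    rw [hcons, h.star_map_S_apply, List.foldr_cons, List.length_cons, Function.iterate_succ_apply]
    by_cases hn : σ j (h.shift n) = n
    · have hiff (m : ℕ) : σ j m = n ↔ m = h.shift n := by
        conv_lhs => rw [← hn, (h.injective j).eq_iff]
      rw [if_pos hn, ih]
      simp only [hiff]
    · have hne (m : ℕ) : σ j m ≠ n := by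
        rintro rfl
        exact hn (by rw [h.shift_branch])
      rw [if_neg hn, if_neg (hne _), map_zero]

theorem mem_coreRange_of_inner_ne_zero (h : IsPermutative π e σ) {i : Fin 2} {v : H}
    (hv : v ∈ coreRange (π (O2.S i))) {m : ℕ} (hm : ⟪e m, v⟫_ℂ ≠ 0) :
    e m ∈ coreRange (π (O2.S i)) := by
  refine mem_coreRange.mpr fun n => ?_
  obtain ⟨u, rfl⟩ := mem_coreRange.mp hv n
  have hword : π (O2.S i) ^ (n + 1) = π (O2.word (List.replicate (n + 1) i)) := by
    rw [O2.word, List.map_replicate, List.prod_replicate, map_pow]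
  rw [hword, ← ContinuousLinearMap.adjoint_inner_left, ← ContinuousLinearMap.star_eq_adjoint,
    h.star_map_word_apply] at hm
  split_ifs at hm with hfold
  · exact ⟨_, by rw [hword, h.map_word_apply, hfold]⟩
  · exact absurd (inner_zero_left _) hm

theorem exists_branch_eq_self (h : IsPermutative π e σ) (hπ : IsIrreducibleRep π) {i : Fin 2}
    (hi : ¬ IsPureIsometry (π (O2.S i))) : ∃ m, σ i m = m := by
  have hcore : coreRange (π (O2.S i)) ≠ ⊥ := fun hbot => hi ⟨O2.star_map_S_mul_map_S π i, hbot⟩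
  obtain ⟨v, hv, hv₀⟩ := Submodule.exists_mem_ne_zero_of_ne_bot hcore
  obtain ⟨m, hm⟩ : ∃ m, ⟪e m, v⟫_ℂ ≠ 0 := by
    by_contra! hzero
    exact hv₀ (e.repr.injective (by ext m; simp [e.repr_apply_apply, hzero]))
  have hem := h.mem_coreRange_of_inner_ne_zero hv hm
  refine ⟨m, by_contra fun hne => ?_⟩
  have hsem : e (σ i m) ∈ coreRange (π (O2.S i)) := h.map_S i m ▸ apply_mem_coreRange hem
  exact (hπ.eq_zero_or_eq_zero_of_mem_coreRange hsem hem (e.orthonormal.2 hne)).elim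
    (e.orthonormal.ne_zero _) (e.orthonormal.ne_zero _)

theorem eq_univ_of_invariant (h : IsPermutative π e σ) (hπ : IsIrreducibleRep π) {s : Set ℕ}
    (hs : s.Nonempty) (hbranch : ∀ j, ∀ n ∈ s, σ j n ∈ s) (hshift : ∀ n ∈ s, h.shift n ∈ s) :
    s = Set.univ := by
  set P := Submodule.span ℂ (e '' s)
  have hinv {T : H →L[ℂ] H} (hT : ∀ n ∈ s, T (e n) ∈ P) : ∀ v ∈ P, T v ∈ P := by
    refine fun v hv => (Submodule.span_le (p := P.comap (T : H →ₗ[ℂ] H))).mpr ?_ hv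
    rintro _ ⟨n, hn, rfl⟩
    exact hT n hn
  have hmem {n : ℕ} (hn : n ∈ s) : e n ∈ P := Submodule.subset_span ⟨n, hn, rfl⟩
  have hS (j : Fin 2) : ∀ v ∈ P, π (O2.S j) v ∈ P :=
    hinv fun n hn => h.map_S j n ▸ hmem (hbranch j n hn)
  have hS' (j : Fin 2) : ∀ v ∈ P, star (π (O2.S j)) v ∈ P := hinv fun n hn => by
    rw [h.star_map_S_apply]
    split_ifs
    exacts [hmem (hshift n hn), P.zero_mem]
  obtain ⟨k, hk⟩ := hs
  have hP : P ≠ ⊥ := fun hbot => e.orthonormal.ne_zero k ((Submodule.mem_bot ℂ).mp (hbot ▸ hmem hk))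
  have hPorth : Pᗮ = ⊥ := (hπ.eq_bot_or_orthogonal_eq_bot hS hS').resolve_left hP
  refine Set.eq_univ_of_forall fun n => by_contra fun hn => e.orthonormal.ne_zero n ?_
  rw [← Submodule.mem_bot ℂ, ← hPorth]
  refine Submodule.isOrtho_span.mpr ?_ (Submodule.mem_span_singleton_self (e n))
  rintro _ rfl _ ⟨m, hm, rfl⟩
  exact e.orthonormal.2 fun hnm => hn (hnm ▸ hm)

theorem exists_iterate_shift_eq (h : IsPermutative π e σ) (hπ : IsIrreducibleRep π) (k m : ℕ) :
    ∃ a b, h.shift^[a] k = h.shift^[b] m := by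
  suffices hs : {n | ∃ a b, h.shift^[a] n = h.shift^[b] m} = Set.univ from
    hs.ge (Set.mem_univ k)
  refine h.eq_univ_of_invariant hπ ⟨m, 0, 0, rfl⟩ ?_ ?_
  · rintro j n ⟨a, b, hab⟩
    exact ⟨a + 1, b, by rw [Function.iterate_succ_apply, h.shift_branch, hab]⟩
  · rintro n ⟨a, b, hab⟩
    refine ⟨a, b + 1, ?_⟩
    rw [← Function.iterate_succ_apply, Function.iterate_succ_apply', hab,
      Function.iterate_succ_apply']

theorem not_isFixedPt_iterate_shift_of_finite (h : IsPermutative π e σ) {k : ℕ} {w : List (Fin 2)}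
    (hw : 2 ≤ w.length) (hk : IsTypePVector π (e k) (.finite w)) (a : ℕ) :
    ¬ Function.IsFixedPt h.shift (h.shift^[a] k) := by
  obtain ⟨hword, hon⟩ := hk
  intro hfix
  have hfold : w.foldr σ k = k :=
    e.orthonormal.linearIndependent.injective (by rw [← h.map_word_apply, hword])
  have hper : k ∈ Function.periodicPts h.shift := by
    have hiter := h.iterate_shift_foldr w k
    rw [hfold] at hiter
    exact ⟨w.length, by omega, hiter⟩
  have hkfix : Function.IsFixedPt h.shift k := by
    rwa [← Function.minimalPeriod_eq_one_iff_isFixedPt,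
      ← Function.minimalPeriod_apply_iterate hper a, Function.minimalPeriod_eq_one_iff_isFixedPt]
  obtain ⟨j, w, rfl⟩ := List.exists_cons_of_length_pos (by omega : 0 < w.length)
  have htail : w.foldr σ k = k := by
    rw [← h.shift_branch j (w.foldr σ k)]
    exact (congrArg h.shift hfold).trans hkfix
  have hjk : σ j k = k := by rwa [List.foldr_cons, htail] at hfold
  have hinj := hon.linearIndependent.injective (a₁ := ⟨0, by omega⟩) (a₂ := ⟨1, hw⟩)
    (by simp [h.map_word_apply, hjk])
  exact absurd hinj (by simp)

theorem not_isFixedPt_iterate_shift_of_infinite (h : IsPermutative π e σ) {k : ℕ} {w : ℕ → Fin 2}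
    (hk : IsTypePVector π (e k) (.infinite w)) (a : ℕ) :
    ¬ Function.IsFixedPt h.shift (h.shift^[a] k) := by
  have hon : Orthonormal ℂ fun n : ℕ => π (star (O2.word (List.ofFn fun j : Fin n => w j))) (e k) :=
    hk
  have hval (n : ℕ) :
      π (star (O2.word (List.ofFn fun j : Fin n => w j))) (e k) = e (h.shift^[n] k) := by
    have hne := hon.ne_zero n
    rw [map_star, h.star_map_word_apply, List.length_ofFn] at hne ⊢
    exact if_pos (by_contra fun hn => hne (if_neg hn))
  intro hfix
  have hinj := hon.linearIndependent.injective (a₁ := a + 1) (a₂ := a)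
    (by simp only [hval, Function.iterate_succ_apply', hfix.eq])
  omega

theorem isPureIsometry_of_isTypePVector (h : IsPermutative π e σ) (hπ : IsIrreducibleRep π)
    {I : MultiIndex} (hI : 2 ≤ I.length) {k : ℕ} (hk : IsTypePVector π (e k) I) (i : Fin 2) :
    IsPureIsometry (π (O2.S i)) := by
  by_contra hi
  obtain ⟨m, hm⟩ := h.exists_branch_eq_self hπ hi
  have hfix : Function.IsFixedPt h.shift m :=
    calc h.shift m = h.shift (σ i m) := by rw [hm]
      _ = m := h.shift_branch i m
  obtain ⟨a, b, hab⟩ := h.exists_iterate_shift_eq hπ k m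
  rw [hfix.iterate b] at hab
  cases I with
  | finite w =>
    exact h.not_isFixedPt_iterate_shift_of_finite (Nat.cast_le.mp hI) hk a (hab ▸ hfix)
  | infinite w => exact h.not_isFixedPt_iterate_shift_of_infinite hk a (hab ▸ hfix)

end IsPermutative

end Permutative

end

theorem mainTheorem6 {H : Type*} [NormedAddCommGroup H] [InnerProductSpace ℂ H]
    [CompleteSpace H] (π : O2 →⋆ₐ[ℂ] (H →L[ℂ] H)) (hπ : IsIrreducibleRep π) :
    ((∀ i, IsPureIsometry (π (O2.S i))) →
      ∀ x : H, ‖x‖ = 1 → HasUniquePureExtension (vectorState π x)) ∧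
    (∀ I : MultiIndex, 2 ≤ I.length → IsTypeP π I →
      ∀ x : H, ‖x‖ = 1 → HasUniquePureExtension (vectorState π x)) := by
  refine ⟨fun hp x hx => hπ.hasUniquePureExtension_vectorState hp hx, ?_⟩
  rintro I hI ⟨e, σ, k, hperm, -, hk⟩ x hx
  exact hπ.hasUniquePureExtension_vectorState (hperm.isPureIsometry_of_isTypePVector hπ hI hk) hx
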